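/- **Conventions.** $\mathbb N=\{1,2,\dots\}$, $A<B$ means $a<b$ for all $a\in A$, $b\in B$ (so it holds if $A$ or $B$ is empty), and $n\le A$ means $n\le a$ for all $a\in A$. The Schreier families are defined by transfinite recursion: $\mathcal S_0=\{\{n\}:n\in\mathbb N\}\cup\{\emptyset\}$, $$\mathcal S_{\gamma+1}=\Big\{\bigcup_{i=1}^nE_i:\ n\le E_1<\dots<E_n,\ E_i\in\mathcal S_\gamma\Big\},\qquad \mathcal S_\xi=\{E:\ \exists n\le E,\ E\in\mathcal S_{\alpha(\xi,n)}\}\ \ (\xi<\omega_1\text{ a limit ordinal}),$$ where (for each countable limit ordinal $\xi$) $(\alpha(\xi,n))_{n\ge1}$ is a fixed strictly increasing sequence of successor ordinals with supremum $\xi$, chosen such that $\alpha(\xi,1)=1$ and such that $A,B\in\mathcal S_{\alpha(\xi,n)}$ with $1<A<B$ implies $A\cup B\in\mathcal S_{\alpha(\xi,n+1)}$ for all $n$. Let $\mathcal F$ be a family of finite subsets of $\mathbb N$. A finite sequence $(E_i)_{i=1}^k$ of nonempty finite subsets of $\mathbb N$ with $\{\min E_i:1\le i\le k\}\in\mathcal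 F$ is called $\mathcal F$-admissible if $E_1<\dots<E_k$, and $\mathcal F$-allowable if the $E_i$ are pairwise disjoint. Let $\mathcal A_2=\{E\subset\mathbb N:|E|\le2\}$ and $\mathcal F[\mathcal A_2]=\{\bigcup_{i=1}^kF_i:F_i\in\mathcal A_2,\ (F_i)_{i=1}^k\ \mathcal F\text{-admissible}\}$. For $0<\theta<1$, let $\|\cdot\|_{\mathcal F,\theta}$ and $\|\cdot\|_{\mathcal F,\theta,M}$ be the norms on the space $c_{00}$ of finitely supported real sequences that are determined by the implicit equation $$\|x\|=\max\Big\{\|x\|_\infty,\ \theta\sup\sum_{i=1}^k\|E_ix\|\Big\},$$ where $E_ix$ is the restriction of $x$ to $E_i$ and the supremum is over all $\mathcal F$-admissible sequences, respectively over all $\mathcal F$-allowable sequences, $(E_i)_{i=1}^k$. The completions of $c_{00}$ under these norms are $T[\mathcal F,\theta]$ and $T_M[\mathcal F,\theta]$. **Theorem 4.2.** For every countable ordinal $\xi$, every $0<\theta<1$ and every $x\in c_{00}$, $$\|x\|_{\mathcal S_\xi,\theta,M}\le\|x\|_{\mathcal S_\xi[\mathcal A_2],\theta}\qquad\text{and}\qquad\|x\|_{\mathcal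 S_\xi,\theta}\le\|x\|_{\mathcal S_\xi,\theta,M}\le3\,\|x\|_{\mathcal S_\xi,\theta}.$$ Consequently, the identity on $c_{00}$ extends to a linear isomorphism $\Phi$ from $T_M[\mathcal S_\xi,\theta]$ onto $T[\mathcal S_\xi,\theta]$ with $\|\Phi y\|\le\|y\|\le3\|\Phi y\|$ for all $y$. -/

import Mathlib

open scoped Ordinal

noncomputable section

namespace Tsirelson

/-! ### Finite sets of positive integers

`ℕ+` is the set of positive integers, and a family of finite sets is a `Set (Finset ℕ+)`. -/

/-- `A < B`: every element of `A` is smaller than every element of `B`. This holds in particular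
when one of the sets is empty. -/
def Before (A B : Finset ℕ+) : Prop := ∀ a ∈ A, ∀ b ∈ B, a < b

/-- `{E₁ ∪ ⋯ ∪ Eₙ : n ≤ E₁ < ⋯ < Eₙ, Eᵢ ∈ 𝒢}`: the family that follows `𝒢` in the Schreier
hierarchy. (The `Eᵢ` may be empty; `n = 0` only contributes the empty set.) -/
def schreierSucc (𝒢 : Set (Finset ℕ+)) : Set (Finset ℕ+) :=
  {A | ∃ (n : ℕ) (E : Fin n → Finset ℕ+),
    (∀ i, E i ∈ 𝒢) ∧ (∀ i, ∀ a ∈ E i, n ≤ (a : ℕ)) ∧ (∀ i j, i < j → Before (E i) (E j)) ∧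
    A = Finset.univ.biUnion E}

/-- The Schreier family `𝒮_ξ`, formed with the sequences `(α ξ n)ₙ` at limit ordinals `ξ`:
* `𝒮_0` consists of the singletons and the empty set;
* `𝒮_{γ+1} = {E₁ ∪ ⋯ ∪ Eₙ : n ≤ E₁ < ⋯ < Eₙ, Eᵢ ∈ 𝒮_γ}`;
* `𝒮_ξ = {E : ∃ n ≤ E, E ∈ 𝒮_{α ξ n}}` for a limit ordinal `ξ`. -/
def schreier (α : Ordinal.{0} → ℕ+ → Ordinal.{0}) (ξ : Ordinal.{0}) : Set (Finset ℕ+) :=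
  Ordinal.limitRecOn (motive := fun _ => Set (Finset ℕ+)) ξ
    {A | A.card ≤ 1}
    (fun _ 𝒢 => schreierSucc 𝒢)
    (fun o _ 𝒢 => {A | ∃ (n : ℕ+) (h : α o n < o), (∀ a ∈ A, n ≤ a) ∧ A ∈ 𝒢 (α o n) h})

theorem schreier_zero (α : Ordinal.{0} → ℕ+ → Ordinal.{0}) :
    schreier α 0 = {A | A.card ≤ 1} := by
  simp [schreier]

theorem schreier_add_one (α : Ordinal.{0} → ℕ+ → Ordinal.{0}) (γ : Ordinal.{0}) :
    schreier α (γ + 1) = schreierSucc (schreier α γ) := by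
  unfold schreier
  rw [Ordinal.limitRecOn_add_one]

theorem schreier_limit (α : Ordinal.{0} → ℕ+ → Ordinal.{0}) {ξ : Ordinal.{0}}
    (hξ : Order.IsSuccLimit ξ) (hα : ∀ n, α ξ n < ξ) :
    schreier α ξ = {A | ∃ n : ℕ+, (∀ a ∈ A, n ≤ a) ∧ A ∈ schreier α (α ξ n)} := by
  ext A
  conv_lhs => unfold schreier
  rw [Ordinal.limitRecOn_limit _ _ _ _ hξ]
  constructor
  · rintro ⟨n, _, h1, h2⟩
    exact ⟨n, h1, h2⟩
  · rintro ⟨n, h1, h2⟩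
    exact ⟨n, hα n, h1, h2⟩

/-- `α` assigns to every countable limit ordinal `ξ` an approximating sequence: successor ordinals
`1 = α ξ 1 < α ξ 2 < ⋯` increasing to `ξ`, such that `A ∪ B ∈ 𝒮_{α ξ (n+1)}` whenever
`A, B ∈ 𝒮_{α ξ n}` and `1 < A < B`. -/
structure IsApproximating (α : Ordinal.{0} → ℕ+ → Ordinal.{0}) : Prop where
  isSucc : ∀ ξ < ω₁, Order.IsSuccLimit ξ → ∀ n, ∃ β, α ξ n = β + 1
  strictMono : ∀ ξ < ω₁, Order.IsSuccLimit ξ → StrictMono (α ξ)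
  isLUB : ∀ ξ < ω₁, Order.IsSuccLimit ξ → IsLUB (Set.range (α ξ)) ξ
  one : ∀ ξ < ω₁, Order.IsSuccLimit ξ → α ξ 1 = 1
  union : ∀ ξ < ω₁, Order.IsSuccLimit ξ → ∀ (n : ℕ+) (A B : Finset ℕ+),
    A ∈ schreier α (α ξ n) → B ∈ schreier α (α ξ n) → (∀ a ∈ A, 1 < a) → (∀ b ∈ B, 1 < b) →
    Before A B → A ∪ B ∈ schreier α (α ξ (n + 1))

/-! ### Admissible and allowable sequences -/

/-- The `Eᵢ` are nonempty and `{min Eᵢ : i} ∈ ℱ`. -/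
def MinsMem (ℱ : Set (Finset ℕ+)) {k : ℕ} (E : Fin k → Finset ℕ+) : Prop :=
  ∃ h : ∀ i, (E i).Nonempty, Finset.univ.image (fun i => (E i).min' (h i)) ∈ ℱ

/-- `E₁ < ⋯ < E_k` and `{min Eᵢ : i} ∈ ℱ`. -/
def IsAdmissible (ℱ : Set (Finset ℕ+)) {k : ℕ} (E : Fin k → Finset ℕ+) : Prop :=
  (∀ i j, i < j → Before (E i) (E j)) ∧ MinsMem ℱ E

/-- `E₁, …, E_k` are pairwise disjoint and `{min Eᵢ : i} ∈ ℱ`. -/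
def IsAllowable (ℱ : Set (Finset ℕ+)) {k : ℕ} (E : Fin k → Finset ℕ+) : Prop :=
  (∀ i j, i ≠ j → Disjoint (E i) (E j)) ∧ MinsMem ℱ E

/-- `ℳ[𝒩]`: the unions of `ℳ`-admissible sequences of sets in `𝒩`. -/
def bracket (ℳ 𝒩 : Set (Finset ℕ+)) : Set (Finset ℕ+) :=
  {A | ∃ (k : ℕ) (F : Fin k → Finset ℕ+),
    (∀ i, F i ∈ 𝒩) ∧ IsAdmissible ℳ F ∧ A = Finset.univ.biUnion F}

/-- `𝒜_n`, the sets with at most `n` elements. -/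
def cardLE (n : ℕ) : Set (Finset ℕ+) := {A | A.card ≤ n}

/-- A class of finite sequences of pairwise disjoint finite sets. The two instances used are the
admissible and the allowable sequences of a family. -/
structure SeqClass where
  Mem : ∀ {k : ℕ}, (Fin k → Finset ℕ+) → Prop
  disjoint : ∀ {k : ℕ} {E : Fin k → Finset ℕ+}, Mem E → ∀ i j, i ≠ j → Disjoint (E i) (E j)

def admissible (ℱ : Set (Finset ℕ+)) : SeqClass where
  Mem E := IsAdmissible ℱ E
  disjoint := by
    intro k E hE i j hij
    rw [Finset.disjoint_left]
    intro a hi hj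
    rcases lt_or_gt_of_ne hij with h | h
    · exact lt_irrefl a (hE.1 i j h a hi a hj)
    · exact lt_irrefl a (hE.1 j i h a hj a hi)

def allowable (ℱ : Set (Finset ℕ+)) : SeqClass where
  Mem E := IsAllowable ℱ E
  disjoint hE := hE.1

/-! ### The implicit norms on `c₀₀ = (ℕ+ →₀ ℝ)` -/

/-- `E x`, the restriction of `x` to the coordinates in `E`. -/
def restr (E : Finset ℕ+) (x : ℕ+ →₀ ℝ) : ℕ+ →₀ ℝ := x.filter (· ∈ E)

/-- `‖x‖_∞`. -/
def supNorm (x : ℕ+ →₀ ℝ) : ℝ := ⨆ n, |x n|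

/-- The sums `∑ᵢ N (Eᵢ x)` over the sequences `(Eᵢ)` of the class. -/
def sums (𝒜 : SeqClass) (N : (ℕ+ →₀ ℝ) → ℝ) (x : ℕ+ →₀ ℝ) : Set ℝ :=
  {r | ∃ (k : ℕ) (E : Fin k → Finset ℕ+), 𝒜.Mem E ∧ r = ∑ i, N (restr (E i) x)}

/-- The right-hand side of the implicit equation,
`max {‖x‖_∞, θ sup {∑ᵢ N (Eᵢ x) : (Eᵢ) in the class}}`. -/
def step (𝒜 : SeqClass) (θ : ℝ) (N : (ℕ+ →₀ ℝ) → ℝ) (x : ℕ+ →₀ ℝ) : ℝ :=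
  max (supNorm x) (θ * sSup (sums 𝒜 N x))

/-- The iterates of `step`, started at `‖·‖_∞`. -/
def iter (𝒜 : SeqClass) (θ : ℝ) : ℕ → (ℕ+ →₀ ℝ) → ℝ
  | 0 => supNorm
  | n + 1 => step 𝒜 θ (iter 𝒜 θ n)

/-- The norm defined implicitly by
`‖x‖ = max {‖x‖_∞, θ sup {∑ᵢ ‖Eᵢ x‖ : (Eᵢ) in the class}}`, constructed as the supremum of the
iterates. For `0 < θ < 1` the theorems `implicitNorm_eq` and `implicitNorm_unique` below say that
it is a solution, and the only one that vanishes at `0` and has finite suprema. -/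
def implicitNorm (𝒜 : SeqClass) (θ : ℝ) (x : ℕ+ →₀ ℝ) : ℝ := ⨆ n, iter 𝒜 θ n x

/-- `‖x‖_{ℱ,θ}`. -/
def tsirelsonNorm (ℱ : Set (Finset ℕ+)) (θ : ℝ) (x : ℕ+ →₀ ℝ) : ℝ :=
  implicitNorm (admissible ℱ) θ x

/-- `‖x‖_{ℱ,θ,M}`. -/
def modifiedNorm (ℱ : Set (Finset ℕ+)) (θ : ℝ) (x : ℕ+ →₀ ℝ) : ℝ :=
  implicitNorm (allowable ℱ) θ x

/-! ### The implicit norm solves the implicit equation and is a norm -/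

/-- `‖x‖_1`, used as an upper bound. -/
def l1 (x : ℕ+ →₀ ℝ) : ℝ := ∑ n ∈ x.support, |x n|

theorem l1_nonneg (x : ℕ+ →₀ ℝ) : 0 ≤ l1 x := Finset.sum_nonneg fun _ _ => abs_nonneg _

theorem abs_le_l1 (x : ℕ+ →₀ ℝ) (n : ℕ+) : |x n| ≤ l1 x := by
  by_cases h : n ∈ x.support
  · exact Finset.single_le_sum (f := fun n => |x n|) (fun _ _ => abs_nonneg _) h
  · rw [Finsupp.notMem_support_iff.1 h, abs_zero]
    exact l1_nonneg x

theorem bddAbove_abs (x : ℕ+ →₀ ℝ) : BddAbove (Set.range fun n => |x n|) :=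
  ⟨l1 x, by rintro _ ⟨n, rfl⟩; exact abs_le_l1 x n⟩

theorem abs_le_supNorm (x : ℕ+ →₀ ℝ) (n : ℕ+) : |x n| ≤ supNorm x :=
  le_ciSup (bddAbove_abs x) n

theorem supNorm_nonneg (x : ℕ+ →₀ ℝ) : 0 ≤ supNorm x :=
  (abs_nonneg _).trans (abs_le_supNorm x 1)

theorem supNorm_le_l1 (x : ℕ+ →₀ ℝ) : supNorm x ≤ l1 x := ciSup_le (abs_le_l1 x)

theorem l1_restr (E : Finset ℕ+) (x : ℕ+ →₀ ℝ) :
    l1 (restr E x) = ∑ n ∈ x.support, if n ∈ E then |x n| else 0 := by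
  unfold l1 restr
  rw [Finsupp.support_filter, Finset.sum_filter]
  refine Finset.sum_congr rfl fun n _ => ?_
  by_cases h : n ∈ E <;> simp [h]

theorem sum_l1_restr_le {k : ℕ} (E : Fin k → Finset ℕ+)
    (hE : ∀ i j, i ≠ j → Disjoint (E i) (E j)) (x : ℕ+ →₀ ℝ) :
    ∑ i, l1 (restr (E i) x) ≤ l1 x := by
  simp only [l1_restr]
  rw [Finset.sum_comm]
  refine Finset.sum_le_sum fun n _ => ?_
  by_cases h : ∃ i, n ∈ E i
  · obtain ⟨i, hi⟩ := h
    rw [Finset.sum_eq_single i]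
    · simp [hi]
    · intro j _ hj
      rw [if_neg]
      exact fun hj' => Finset.disjoint_left.1 (hE i j (Ne.symm hj)) hi hj'
    · simp
  · push Not at h
    rw [Finset.sum_eq_zero]
    · exact abs_nonneg _
    · intro i _
      rw [if_neg (h i)]

section

variable {𝒜 : SeqClass} {θ : ℝ}

theorem sums_le {N : (ℕ+ →₀ ℝ) → ℝ} (hN : ∀ x, N x ≤ l1 x) {x : ℕ+ →₀ ℝ} {r : ℝ}
    (hr : r ∈ sums 𝒜 N x) : r ≤ l1 x := by
  obtain ⟨k, E, hE, rfl⟩ := hr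
  exact (Finset.sum_le_sum fun i _ => hN _).trans (sum_l1_restr_le E (𝒜.disjoint hE) x)

theorem bddAbove_sums {N : (ℕ+ →₀ ℝ) → ℝ} (hN : ∀ x, N x ≤ l1 x) (x : ℕ+ →₀ ℝ) :
    BddAbove (sums 𝒜 N x) := ⟨l1 x, fun _ hr => sums_le hN hr⟩

theorem sSup_sums_nonneg {N : (ℕ+ →₀ ℝ) → ℝ} (hN : ∀ x, 0 ≤ N x) (x : ℕ+ →₀ ℝ) :
    0 ≤ sSup (sums 𝒜 N x) := by
  refine Real.sSup_nonneg ?_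
  rintro _ ⟨k, E, _, rfl⟩
  exact Finset.sum_nonneg fun _ _ => hN _

theorem step_mono (hθ0 : 0 ≤ θ) {N N' : (ℕ+ →₀ ℝ) → ℝ} (h0 : ∀ x, 0 ≤ N' x)
    (h1 : ∀ x, N' x ≤ l1 x) (h : ∀ x, N x ≤ N' x) (x : ℕ+ →₀ ℝ) :
    step 𝒜 θ N x ≤ step 𝒜 θ N' x := by
  refine max_le_max le_rfl (mul_le_mul_of_nonneg_left (Real.sSup_le ?_ ?_) hθ0)
  · rintro _ ⟨k, E, hE, rfl⟩
    exact (Finset.sum_le_sum fun i _ => h _).trans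
      (le_csSup (bddAbove_sums h1 x) ⟨k, E, hE, rfl⟩)
  · exact sSup_sums_nonneg h0 x

theorem iter_nonneg (n : ℕ) (x : ℕ+ →₀ ℝ) : 0 ≤ iter 𝒜 θ n x := by
  cases n with
  | zero => exact supNorm_nonneg x
  | succ n => exact (supNorm_nonneg x).trans (le_max_left _ _)

theorem iter_le_l1 (hθ0 : 0 ≤ θ) (hθ1 : θ ≤ 1) (n : ℕ) (x : ℕ+ →₀ ℝ) :
    iter 𝒜 θ n x ≤ l1 x := by
  induction n generalizing x with
  | zero => exact supNorm_le_l1 x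
  | succ n ih =>
    refine max_le (supNorm_le_l1 x) ?_
    have h : sSup (sums 𝒜 (iter 𝒜 θ n) x) ≤ l1 x :=
      Real.sSup_le (fun r hr => sums_le ih hr) (l1_nonneg x)
    calc θ * sSup (sums 𝒜 (iter 𝒜 θ n) x) ≤ θ * l1 x := mul_le_mul_of_nonneg_left h hθ0
      _ ≤ 1 * l1 x := mul_le_mul_of_nonneg_right hθ1 (l1_nonneg x)
      _ = l1 x := one_mul _

theorem iter_le_succ (hθ0 : 0 ≤ θ) (hθ1 : θ ≤ 1) (n : ℕ) (x : ℕ+ →₀ ℝ) :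
    iter 𝒜 θ n x ≤ iter 𝒜 θ (n + 1) x := by
  induction n generalizing x with
  | zero => exact le_max_left _ _
  | succ n ih =>
    exact step_mono hθ0 (fun y => iter_nonneg _ y) (fun y => iter_le_l1 hθ0 hθ1 _ y) ih x

theorem iter_mono (hθ0 : 0 ≤ θ) (hθ1 : θ ≤ 1) (x : ℕ+ →₀ ℝ) :
    Monotone fun n => iter 𝒜 θ n x :=
  monotone_nat_of_le_succ fun n => iter_le_succ hθ0 hθ1 n x

theorem bddAbove_iter (hθ0 : 0 ≤ θ) (hθ1 : θ ≤ 1) (x : ℕ+ →₀ ℝ) :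
    BddAbove (Set.range fun n => iter 𝒜 θ n x) :=
  ⟨l1 x, by rintro _ ⟨n, rfl⟩; exact iter_le_l1 hθ0 hθ1 n x⟩

theorem tendsto_iter (hθ0 : 0 ≤ θ) (hθ1 : θ ≤ 1) (x : ℕ+ →₀ ℝ) :
    Filter.Tendsto (fun n => iter 𝒜 θ n x) Filter.atTop (nhds (implicitNorm 𝒜 θ x)) :=
  tendsto_atTop_ciSup (iter_mono hθ0 hθ1 x) (bddAbove_iter hθ0 hθ1 x)

theorem iter_le_implicitNorm (hθ0 : 0 ≤ θ) (hθ1 : θ ≤ 1) (n : ℕ) (x : ℕ+ →₀ ℝ) :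
    iter 𝒜 θ n x ≤ implicitNorm 𝒜 θ x :=
  le_ciSup (f := fun n => iter 𝒜 θ n x) (bddAbove_iter hθ0 hθ1 x) n

theorem supNorm_le_implicitNorm (hθ0 : 0 ≤ θ) (hθ1 : θ ≤ 1) (x : ℕ+ →₀ ℝ) :
    supNorm x ≤ implicitNorm 𝒜 θ x := iter_le_implicitNorm hθ0 hθ1 0 x

theorem implicitNorm_nonneg (hθ0 : 0 ≤ θ) (hθ1 : θ ≤ 1) (x : ℕ+ →₀ ℝ) :
    0 ≤ implicitNorm 𝒜 θ x := (supNorm_nonneg x).trans (supNorm_le_implicitNorm hθ0 hθ1 x)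

theorem implicitNorm_le_l1 (hθ0 : 0 ≤ θ) (hθ1 : θ ≤ 1) (x : ℕ+ →₀ ℝ) :
    implicitNorm 𝒜 θ x ≤ l1 x := ciSup_le fun n => iter_le_l1 hθ0 hθ1 n x

/-- The implicit equation. The supremum is finite by `bddAbove_sums` and
`implicitNorm_le_l1`. -/
theorem implicitNorm_eq (hθ0 : 0 ≤ θ) (hθ1 : θ ≤ 1) (x : ℕ+ →₀ ℝ) :
    implicitNorm 𝒜 θ x = max (supNorm x) (θ * sSup (sums 𝒜 (implicitNorm 𝒜 θ) x)) := by
  apply le_antisymm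
  · refine ciSup_le fun n => ?_
    cases n with
    | zero => exact le_max_left _ _
    | succ n =>
      exact step_mono hθ0 (implicitNorm_nonneg hθ0 hθ1) (implicitNorm_le_l1 hθ0 hθ1)
        (iter_le_implicitNorm hθ0 hθ1 n) x
  · refine max_le (supNorm_le_implicitNorm hθ0 hθ1 x) ?_
    rw [← smul_eq_mul, ← Real.sSup_smul_of_nonneg hθ0]
    refine Real.sSup_le ?_ (implicitNorm_nonneg hθ0 hθ1 x)
    rintro _ ⟨_, ⟨k, E, hE, rfl⟩, rfl⟩
    have ht : Filter.Tendsto (fun n => θ * ∑ i, iter 𝒜 θ n (restr (E i) x)) Filter.atTop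
        (nhds (θ * ∑ i, implicitNorm 𝒜 θ (restr (E i) x))) :=
      (tendsto_finsetSum _ fun i _ => tendsto_iter hθ0 hθ1 _).const_mul θ
    refine le_of_tendsto' ht fun n => ?_
    refine le_trans ?_ (iter_le_implicitNorm hθ0 hθ1 (n + 1) x)
    refine le_trans ?_ (le_max_right _ _)
    exact mul_le_mul_of_nonneg_left
      (le_csSup (bddAbove_sums (fun y => iter_le_l1 hθ0 hθ1 n y) x) ⟨k, E, hE, rfl⟩) hθ0

theorem restr_zero (E : Finset ℕ+) : restr E 0 = 0 := Finsupp.filter_zero _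

theorem restr_add (E : Finset ℕ+) (x y : ℕ+ →₀ ℝ) : restr E (x + y) = restr E x + restr E y :=
  Finsupp.filter_add

theorem restr_smul (E : Finset ℕ+) (c : ℝ) (x : ℕ+ →₀ ℝ) : restr E (c • x) = c • restr E x :=
  Finsupp.filter_smul

theorem solution_le (hθ0 : 0 ≤ θ) (hθ1 : θ < 1) {M N : (ℕ+ →₀ ℝ) → ℝ}
    (hM0 : M 0 = 0) (hM : ∀ x, M x = step 𝒜 θ M x)
    (hN : ∀ x, N x = step 𝒜 θ N x) (hNb : ∀ x, BddAbove (sums 𝒜 N x)) (x : ℕ+ →₀ ℝ)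
    (ih : ∀ y : ℕ+ →₀ ℝ, y.support.card < x.support.card → M y = N y) : M x ≤ N x := by
  have hN0 : 0 ≤ N x := by rw [hN]; exact (supNorm_nonneg x).trans (le_max_left _ _)
  have hM0' : 0 ≤ M x := by rw [hM]; exact (supNorm_nonneg x).trans (le_max_left _ _)
  have key : M x ≤ max (N x) (θ * M x) := by
    conv_lhs => rw [hM]
    refine max_le ?_ ?_
    · refine le_trans ?_ (le_max_left _ _)
      rw [hN]
      exact le_max_left _ _
    · rw [← smul_eq_mul, ← Real.sSup_smul_of_nonneg hθ0]
      refine Real.sSup_le ?_ (hN0.trans (le_max_left _ _))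
      rintro _ ⟨_, ⟨k, E, hE, rfl⟩, rfl⟩
      by_cases h : ∃ i, restr (E i) x = x
      · obtain ⟨i, hi⟩ := h
        refine le_trans (le_of_eq ?_) (le_max_right _ _)
        change θ * _ = _
        rw [Finset.sum_eq_single i, hi]
        · intro j _ hj
          rw [← hM0]
          congr 1
          ext n
          unfold restr
          by_cases hn : n ∈ E j
          · have hn' : n ∉ E i := fun h' =>
              Finset.disjoint_left.1 (𝒜.disjoint hE i j (Ne.symm hj)) h' hn
            rw [Finsupp.filter_apply_pos _ _ hn, ← hi]
            exact Finsupp.filter_apply_neg _ _ hn'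
          · rw [Finsupp.filter_apply_neg _ _ hn]
            rfl
        · simp
      · push Not at h
        refine le_trans ?_ (le_max_left _ _)
        have : ∀ i, M (restr (E i) x) = N (restr (E i) x) := by
          intro i
          apply ih
          apply Finset.card_lt_card
          refine Finset.ssubset_iff_subset_ne.2 ⟨?_, ?_⟩
          · unfold restr
            rw [Finsupp.support_filter]
            exact Finset.filter_subset _ _
          · intro hs
            apply h i
            unfold restr at hs ⊢
            rw [Finsupp.filter_eq_self_iff]
            intro n hn
            have hn' := Finsupp.mem_support_iff.2 hn
            rw [← hs, Finsupp.support_filter] at hn'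
            exact (Finset.mem_filter.1 hn').2
        change θ * _ ≤ _
        rw [Finset.sum_congr rfl fun i _ => this i, hN]
        refine le_trans ?_ (le_max_right _ _)
        exact mul_le_mul_of_nonneg_left (le_csSup (hNb x) ⟨k, E, hE, rfl⟩) hθ0
  rcases le_max_iff.1 key with h | h
  · exact h
  · nlinarith

/-- Uniqueness of the solution of the implicit equation. -/
theorem implicitNorm_unique (hθ0 : 0 ≤ θ) (hθ1 : θ < 1) {M : (ℕ+ →₀ ℝ) → ℝ} (hM0 : M 0 = 0)
    (hMb : ∀ x, BddAbove (sums 𝒜 M x))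
    (hM : ∀ x, M x = max (supNorm x) (θ * sSup (sums 𝒜 M x))) : M = implicitNorm 𝒜 θ := by
  have h0 : implicitNorm 𝒜 θ 0 = 0 :=
    le_antisymm ((implicitNorm_le_l1 hθ0 hθ1.le 0).trans (by simp [l1]))
      (implicitNorm_nonneg hθ0 hθ1.le 0)
  have main : ∀ (m : ℕ) (x : ℕ+ →₀ ℝ), x.support.card = m → M x = implicitNorm 𝒜 θ x := by
    intro m
    induction m using Nat.strong_induction_on with
    | _ m ih =>
      intro x hx
      apply le_antisymm
      · exact solution_le hθ0 hθ1 hM0 hM (implicitNorm_eq hθ0 hθ1.le)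
          (bddAbove_sums (implicitNorm_le_l1 hθ0 hθ1.le)) x
          (fun y hy => ih _ (hx ▸ hy) y rfl)
      · exact solution_le hθ0 hθ1 h0 (implicitNorm_eq hθ0 hθ1.le) hM hMb x
          (fun y hy => (ih _ (hx ▸ hy) y rfl).symm)
  funext x
  exact main _ x rfl

theorem iter_add_le (hθ0 : 0 ≤ θ) (hθ1 : θ ≤ 1) (n : ℕ) (x y : ℕ+ →₀ ℝ) :
    iter 𝒜 θ n (x + y) ≤ iter 𝒜 θ n x + iter 𝒜 θ n y := by
  have hs : supNorm (x + y) ≤ supNorm x + supNorm y :=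
    ciSup_le fun m => (abs_add_le (x m) (y m)).trans
      (add_le_add (abs_le_supNorm x m) (abs_le_supNorm y m))
  induction n generalizing x y with
  | zero => exact hs
  | succ n ih =>
    refine max_le (hs.trans (add_le_add (le_max_left _ _) (le_max_left _ _))) ?_
    refine le_trans ?_ (add_le_add (le_max_right _ _) (le_max_right _ _))
    rw [← mul_add]
    refine mul_le_mul_of_nonneg_left (Real.sSup_le ?_ ?_) hθ0
    · rintro _ ⟨k, E, hE, rfl⟩
      have hb := fun z => bddAbove_sums (𝒜 := 𝒜) (fun y => iter_le_l1 (𝒜 := 𝒜) hθ0 hθ1 n y) z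
      calc ∑ i, iter 𝒜 θ n (restr (E i) (x + y))
          ≤ ∑ i, (iter 𝒜 θ n (restr (E i) x) + iter 𝒜 θ n (restr (E i) y)) := by
            refine Finset.sum_le_sum fun i _ => ?_
            rw [restr_add]
            refine ih _ _ (ciSup_le fun m => (abs_add_le _ _).trans
              (add_le_add (abs_le_supNorm _ m) (abs_le_supNorm _ m)))
        _ = ∑ i, iter 𝒜 θ n (restr (E i) x) + ∑ i, iter 𝒜 θ n (restr (E i) y) :=
            Finset.sum_add_distrib
        _ ≤ _ := add_le_add (le_csSup (hb x) ⟨k, E, hE, rfl⟩) (le_csSup (hb y) ⟨k, E, hE, rfl⟩)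
    · exact add_nonneg (sSup_sums_nonneg (iter_nonneg n) x) (sSup_sums_nonneg (iter_nonneg n) y)

theorem implicitNorm_add_le (hθ0 : 0 ≤ θ) (hθ1 : θ ≤ 1) (x y : ℕ+ →₀ ℝ) :
    implicitNorm 𝒜 θ (x + y) ≤ implicitNorm 𝒜 θ x + implicitNorm 𝒜 θ y :=
  ciSup_le fun n => (iter_add_le hθ0 hθ1 n x y).trans
    (add_le_add (iter_le_implicitNorm hθ0 hθ1 n x) (iter_le_implicitNorm hθ0 hθ1 n y))

theorem supNorm_smul (c : ℝ) (x : ℕ+ →₀ ℝ) : supNorm (c • x) = |c| * supNorm x := by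
  unfold supNorm
  rw [Real.mul_iSup_of_nonneg (abs_nonneg c)]
  simp [abs_mul]

open scoped Pointwise in
theorem iter_smul (n : ℕ) (c : ℝ) (x : ℕ+ →₀ ℝ) :
    iter 𝒜 θ n (c • x) = |c| * iter 𝒜 θ n x := by
  induction n generalizing x with
  | zero => exact supNorm_smul c x
  | succ n ih =>
    have hs : sums 𝒜 (iter 𝒜 θ n) (c • x) = |c| • sums 𝒜 (iter 𝒜 θ n) x := by
      ext r
      simp only [sums, restr_smul, ih, ← Finset.mul_sum]
      constructor
      · rintro ⟨k, E, hE, rfl⟩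
        exact ⟨_, ⟨k, E, hE, rfl⟩, rfl⟩
      · rintro ⟨_, ⟨k, E, hE, rfl⟩, rfl⟩
        exact ⟨k, E, hE, rfl⟩
    change max _ _ = |c| * max _ _
    rw [hs, Real.sSup_smul_of_nonneg (abs_nonneg c), supNorm_smul,
      mul_max_of_nonneg _ _ (abs_nonneg c), smul_eq_mul]
    ring_nf

theorem implicitNorm_smul (c : ℝ) (x : ℕ+ →₀ ℝ) :
    implicitNorm 𝒜 θ (c • x) = |c| * implicitNorm 𝒜 θ x := by
  unfold implicitNorm
  rw [Real.mul_iSup_of_nonneg (abs_nonneg c)]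
  simp only [iter_smul]

theorem eq_zero_of_implicitNorm (hθ0 : 0 ≤ θ) (hθ1 : θ ≤ 1) (x : ℕ+ →₀ ℝ)
    (h : implicitNorm 𝒜 θ x = 0) : x = 0 := by
  ext n
  have := (abs_le_supNorm x n).trans (supNorm_le_implicitNorm (𝒜 := 𝒜) hθ0 hθ1 x)
  rw [h] at this
  exact abs_nonpos_iff.1 this

end

/-! ### The spaces `T[ℱ, θ]` and `T_M[ℱ, θ]` -/

/-- `c₀₀` with the implicit norm. -/
def C00 (_𝒜 : SeqClass) (_θ : Set.Ioo (0 : ℝ) 1) : Type := ℕ+ →₀ ℝ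

instance (𝒜 : SeqClass) (θ : Set.Ioo (0 : ℝ) 1) : AddCommGroup (C00 𝒜 θ) :=
  inferInstanceAs (AddCommGroup (ℕ+ →₀ ℝ))

instance (𝒜 : SeqClass) (θ : Set.Ioo (0 : ℝ) 1) : Module ℝ (C00 𝒜 θ) :=
  inferInstanceAs (Module ℝ (ℕ+ →₀ ℝ))

instance (𝒜 : SeqClass) (θ : Set.Ioo (0 : ℝ) 1) : Norm (C00 𝒜 θ) where
  norm x := implicitNorm 𝒜 θ x

theorem C00.core (𝒜 : SeqClass) (θ : Set.Ioo (0 : ℝ) 1) :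
    NormedSpace.Core ℝ (C00 𝒜 θ) where
  norm_nonneg x := implicitNorm_nonneg θ.2.1.le θ.2.2.le x
  norm_smul c x := implicitNorm_smul c x
  norm_triangle x y := implicitNorm_add_le θ.2.1.le θ.2.2.le x y
  norm_eq_zero_iff x := by
    constructor
    · exact eq_zero_of_implicitNorm θ.2.1.le θ.2.2.le x
    · rintro rfl
      have h := implicitNorm_smul (𝒜 := 𝒜) (θ := θ) 0 0
      rwa [zero_smul, abs_zero, zero_mul] at h

instance (𝒜 : SeqClass) (θ : Set.Ioo (0 : ℝ) 1) : NormedAddCommGroup (C00 𝒜 θ) :=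
  NormedAddCommGroup.ofCore (C00.core 𝒜 θ)

instance (𝒜 : SeqClass) (θ : Set.Ioo (0 : ℝ) 1) : NormedSpace ℝ (C00 𝒜 θ) :=
  NormedSpace.ofCore (C00.core 𝒜 θ)

/-- The completion of `c₀₀` under the implicit norm. -/
abbrev ImplicitSpace (𝒜 : SeqClass) (θ : Set.Ioo (0 : ℝ) 1) : Type :=
  UniformSpace.Completion (C00 𝒜 θ)

/-- The inclusion of `c₀₀` into its completion. -/
def incl (𝒜 : SeqClass) (θ : Set.Ioo (0 : ℝ) 1) (x : ℕ+ →₀ ℝ) : ImplicitSpace 𝒜 θ :=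
  ((show C00 𝒜 θ from x : C00 𝒜 θ) : UniformSpace.Completion (C00 𝒜 θ))

theorem norm_incl (𝒜 : SeqClass) (θ : Set.Ioo (0 : ℝ) 1) (x : ℕ+ →₀ ℝ) :
    ‖incl 𝒜 θ x‖ = implicitNorm 𝒜 θ x :=
  UniformSpace.Completion.norm_coe (E := C00 𝒜 θ) x

/-- The Tsirelson space `T[ℱ, θ]`. -/
abbrev TsirelsonSpace (ℱ : Set (Finset ℕ+)) (θ : Set.Ioo (0 : ℝ) 1) : Type :=
  ImplicitSpace (admissible ℱ) θ

/-- The modified Tsirelson space `T_M[ℱ, θ]`. -/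
abbrev ModifiedSpace (ℱ : Set (Finset ℕ+)) (θ : Set.Ioo (0 : ℝ) 1) : Type :=
  ImplicitSpace (allowable ℱ) θ

end Tsirelson

end

open scoped Ordinal

namespace Tsirelson

/-! ### Schreier families -/

/-! Unfolding the implicit equation turns both norms into sums over trees: a leaf `a` of level `d a`
contributes `θ ^ d a * |x a|`. Such sums are bounded by the norm (`Tree.sum_le`), and allowable
trees approach the modified norm (`IsRegular.exists_tree`). It therefore suffices to rearrange an
allowable tree into few admissible ones without changing the level of any leaf.

The obstacle is that the successors of a node may interlace. The decisive property of `𝒮_ξ` is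
`reorderable_schreier`: a partition of a finite set into members of `𝒮_ξ`, with labels not exceeding
the points they label, can be replaced by a partition into consecutive members that uses no new
labels. This reduces to an exchange between two members, by taking a lexicographically least
labelling. `IsRegular.exists_pairSet` applies it level by level. The inner nodes of a level become
consecutive, but the leaves of that level cannot move and cut through them; hence the successors
come in pairs, an inner node followed by a leaf. A pair has two minima but only one label, so the
result is an admissible tree for `𝒮_ξ[𝒜_2]` (`PairNode.pieces_bracket`), which gives the first
inequality.

To return to `𝒮_ξ` with `ξ ≥ 1`, suppose that the inner nodes of the next level have been cut into
two consecutive admissible trees each. Every pair then has at most three parts, and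
`exists_two_schreier` divides the minima of all parts into two consecutive members of `𝒮_ξ`. The
node itself is thus cut into two admissible trees, so the number two reproduces itself up to the
root (`PairNode.pieces_schreier`). This gives the constant 2, which is better than the 3 required.
For `ξ = 0` allowable sequences have at most one term and are admissible. The lower estimate holds
because admissible sequences are allowable, and the isomorphism follows by density. -/

theorem before_fiber {ρ : ℕ+ → ℕ+} {A : Finset ℕ+} (hρ : MonotoneOn ρ A) {p q : ℕ+}
    (h : p < q) : Before (A.filter (ρ · = p)) (A.filter (ρ · = q)) := by
  intro a ha b hb
  rw [Finset.mem_filter] at ha hb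
  by_contra hab
  have := hρ hb.1 ha.1 (not_lt.1 hab)
  rw [ha.2, hb.2] at this
  exact absurd this (not_le.2 h)

/-- Throughout, a partition into consecutive sets is encoded as the fibers of a function that is
monotone on the set. Here the sets `Eᵢ` are the nonempty fibers in the order of their labels, so
that `n` is the number of labels in use. -/
theorem mem_schreierSucc_of_monotoneOn {𝒢 : Set (Finset ℕ+)} {ρ : ℕ+ → ℕ+} {A : Finset ℕ+}
    (hρ : MonotoneOn ρ A) (hf : ∀ p, A.filter (ρ · = p) ∈ 𝒢)
    (hc : ∀ a ∈ A, (A.image ρ).card ≤ (a : ℕ)) : A ∈ schreierSucc 𝒢 := by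
  refine ⟨(A.image ρ).card,
    fun i => A.filter (ρ · = (A.image ρ).orderEmbOfFin rfl i), fun i => hf _, ?_, ?_, ?_⟩
  · intro i a ha
    exact hc a (Finset.mem_filter.1 ha).1
  · intro i j hij
    exact before_fiber hρ (by simpa using hij)
  · ext a
    simp only [Finset.mem_biUnion, Finset.mem_univ, true_and, Finset.mem_filter]
    constructor
    · intro ha
      have h : ρ a ∈ Set.range ((A.image ρ).orderEmbOfFin rfl) := by
        rw [Finset.range_orderEmbOfFin]
        exact Finset.mem_coe.2 (Finset.mem_image_of_mem _ ha)
      obtain ⟨i, hi⟩ := h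
      exact ⟨i, ha, hi.symm⟩
    · rintro ⟨_, h, _⟩
      exact h

/-- Every family of pairwise disjoint nonempty sets has a function sending each point to the
minimum of its set. -/
theorem exists_head {k : ℕ} (E : Fin k → Finset ℕ+) (hE : ∀ i j, i ≠ j → Disjoint (E i) (E j)) :
    ∃ σ : ℕ+ → ℕ+, ∀ i, ∀ x ∈ E i, σ x ∈ E i ∧ ∀ y ∈ E i, σ x ≤ y := by
  classical
  refine ⟨fun x => if h : ∃ i, x ∈ E i then (E h.choose).min' ⟨x, h.choose_spec⟩ else x, ?_⟩
  intro i x hx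
  have h : ∃ i, x ∈ E i := ⟨i, hx⟩
  have hi : h.choose = i := by
    by_contra hne
    exact Finset.disjoint_left.1 (hE _ _ hne) h.choose_spec hx
  simp only [dif_pos h, hi]
  exact ⟨Finset.min'_mem _ _, fun y hy => Finset.min'_le _ _ hy⟩

theorem disjoint_of_before {k : ℕ} {E : Fin k → Finset ℕ+}
    (hE : ∀ i j, i < j → Before (E i) (E j)) : ∀ i j, i ≠ j → Disjoint (E i) (E j) := by
  intro i j hij
  rw [Finset.disjoint_left]
  intro a hi hj
  rcases lt_or_gt_of_ne hij with h | h
  · exact lt_irrefl a (hE i j h a hi a hj)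
  · exact lt_irrefl a (hE j i h a hj a hi)

/-- Converse encoding: each point is labelled by the minimum of its block, which makes the labels
points of `A` with `ρ x ≤ x`. -/
theorem exists_monotoneOn_of_mem_schreierSucc {𝒢 : Set (Finset ℕ+)} (h0 : ∅ ∈ 𝒢)
    {A : Finset ℕ+} (hA : A ∈ schreierSucc 𝒢) :
    ∃ ρ : ℕ+ → ℕ+, MonotoneOn ρ A ∧ (∀ x ∈ A, ρ x ∈ A ∧ ρ x ≤ x) ∧
      (∀ p, A.filter (ρ · = p) ∈ 𝒢) ∧ ∀ a ∈ A, (A.image ρ).card ≤ (a : ℕ) := by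
  classical
  obtain ⟨n, E, hE, hn, hb, rfl⟩ := hA
  obtain ⟨σ, hσ⟩ := exists_head E (disjoint_of_before hb)
  have key : ∀ x i y j, x ∈ E i → y ∈ E j → x ≤ y → i ≤ j := by
    intro x i y j hx hy hxy
    by_contra hij
    exact absurd (hb j i (not_le.1 hij) y hy x hx) (not_lt.2 hxy)
  refine ⟨σ, ?_, ?_, ?_, ?_⟩
  · intro x hx y hy hxy
    simp only [Finset.coe_biUnion, Set.mem_iUnion, Finset.mem_coe, Finset.mem_univ,
      exists_prop, true_and] at hx hy
    obtain ⟨i, hi⟩ := hx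
    obtain ⟨j, hj⟩ := hy
    rcases (key x i y j hi hj hxy).eq_or_lt with rfl | hij
    · exact (hσ i x hi).2 _ (hσ i y hj).1
    · exact (hb i j hij _ (hσ i x hi).1 _ (hσ j y hj).1).le
  · intro x hx
    simp only [Finset.mem_biUnion, Finset.mem_univ, true_and] at hx ⊢
    obtain ⟨i, hi⟩ := hx
    exact ⟨⟨i, (hσ i x hi).1⟩, (hσ i x hi).2 x hi⟩
  · intro p
    by_cases h : ∃ i, ∃ x ∈ E i, σ x = p
    · obtain ⟨i, x, hx, rfl⟩ := h
      convert hE i using 1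
      ext y
      simp only [Finset.mem_filter, Finset.mem_biUnion, Finset.mem_univ, true_and]
      constructor
      · rintro ⟨⟨j, hj⟩, hyx⟩
        have h1 := (hσ j y hj).1
        rw [hyx] at h1
        have : i = j := by
          by_contra hne
          exact Finset.disjoint_left.1 (disjoint_of_before hb i j hne) (hσ i x hx).1 h1
        rwa [this]
      · intro hy
        exact ⟨⟨i, hy⟩, le_antisymm ((hσ i y hy).2 _ (hσ i x hx).1)
          ((hσ i x hx).2 _ (hσ i y hy).1)⟩
    · convert h0
      rw [Finset.filter_eq_empty_iff]
      intro y hy hyp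
      simp only [Finset.mem_biUnion, Finset.mem_univ, true_and] at hy
      obtain ⟨i, hi⟩ := hy
      exact h ⟨i, y, hi, hyp⟩
  · intro a ha
    simp only [Finset.mem_biUnion, Finset.mem_univ, true_and] at ha
    obtain ⟨i, hi⟩ := ha
    refine le_trans ?_ (hn i a hi)
    -- Every label is the minimum of some `E i`, so there are at most `n` labels. The value 1 for
    -- empty blocks is only a filler.
    have : (Finset.univ.biUnion E).image σ ⊆ Finset.univ.image
        (fun i => if h : (E i).Nonempty then (E i).min' h else 1) := by
      intro p hp
      simp only [Finset.mem_image, Finset.mem_biUnion, Finset.mem_univ, true_and] at hp ⊢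
      obtain ⟨x, ⟨j, hj⟩, rfl⟩ := hp
      refine ⟨j, ?_⟩
      rw [dif_pos ⟨x, hj⟩]
      exact le_antisymm (Finset.min'_le _ _ (hσ j x hj).1)
        ((hσ j x hj).2 _ (Finset.min'_mem _ _))
    refine (Finset.card_le_card this).trans (Finset.card_image_le.trans ?_)
    simp

section

variable {α : Ordinal.{0} → ℕ+ → Ordinal.{0}}

theorem IsApproximating.lt (hα : IsApproximating α) {ξ : Ordinal.{0}} (h1 : ξ < ω₁)
    (hξ : Order.IsSuccLimit ξ) (n : ℕ+) : α ξ n < ξ :=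
  (hα.strictMono ξ h1 hξ (PNat.lt_add_right n 1)).trans_le
    ((hα.isLUB ξ h1 hξ).1 ⟨n + 1, rfl⟩)

theorem IsApproximating.schreier_limit (hα : IsApproximating α) {ξ : Ordinal.{0}} (h1 : ξ < ω₁)
    (hξ : Order.IsSuccLimit ξ) :
    schreier α ξ = {A | ∃ n : ℕ+, (∀ a ∈ A, n ≤ a) ∧ A ∈ schreier α (α ξ n)} :=
  Tsirelson.schreier_limit α hξ (hα.lt h1 hξ)

/-- At a limit ordinal only the families of index `α ξ n` enter the definition of `𝒮_ξ`, so the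
limit step needs the induction hypothesis for these alone. -/
theorem IsApproximating.induction (hα : IsApproximating α)
    {motive : ∀ ξ : Ordinal.{0}, ξ < ω₁ → Prop}
    (zero : ∀ h, motive 0 h)
    (succ : ∀ γ (hγ : γ < ω₁), motive γ hγ → ∀ h, motive (γ + 1) h)
    (limit : ∀ ξ (h1 : ξ < ω₁) (hξ : Order.IsSuccLimit ξ),
      (∀ n, motive (α ξ n) ((hα.lt h1 hξ n).trans h1)) → motive ξ h1)
    (ξ : Ordinal.{0}) (h1 : ξ < ω₁) : motive ξ h1 := by
  induction ξ using Ordinal.limitRecOn with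
  | zero => exact zero h1
  | add_one γ ih =>
    have h : γ < ω₁ := (Order.lt_add_one_iff.2 le_rfl).trans h1
    exact succ γ h (ih h) h1
  | limit ξ hξ ih => exact limit ξ h1 hξ fun n => ih _ (hα.lt h1 hξ n) ((hα.lt h1 hξ n).trans h1)

/-! ### Heredity and spreading of Schreier families -/

theorem singleton_mem_schreier (hα : IsApproximating α) {ξ : Ordinal.{0}} (h1 : ξ < ω₁)
    (b : ℕ+) : {b} ∈ schreier α ξ := by
  induction ξ, h1 using hα.induction with
  | zero _ => simp [schreier_zero]
  | succ γ _ ih _ =>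
    rw [schreier_add_one]
    refine ⟨1, fun _ => {b}, fun _ => ih, ?_, ?_, by simp⟩
    · intro i a _
      exact a.pos
    · intro i j hij
      omega
  | limit ξ h1 hξ ih =>
    rw [hα.schreier_limit h1 hξ]
    exact ⟨1, fun a _ => one_le, ih 1⟩

theorem mem_schreier_of_subset (hα : IsApproximating α) {ξ : Ordinal.{0}} (h1 : ξ < ω₁)
    {A B : Finset ℕ+} (hA : A ∈ schreier α ξ) (hB : B ⊆ A) : B ∈ schreier α ξ := by
  induction ξ, h1 using hα.induction generalizing A B with
  | zero _ =>
    rw [schreier_zero] at *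
    exact (Finset.card_le_card hB).trans hA
  | succ γ hγ ih _ =>
    rw [schreier_add_one] at *
    obtain ⟨n, E, hE, hn, hb, rfl⟩ := hA
    refine ⟨n, fun i => E i ∩ B, fun i => ih (hE i) Finset.inter_subset_left, ?_, ?_, ?_⟩
    · intro i a ha
      exact hn i a (Finset.mem_inter.1 ha).1
    · intro i j hij a ha b hb'
      exact hb i j hij a (Finset.mem_inter.1 ha).1 b (Finset.mem_inter.1 hb').1
    · rw [← Finset.biUnion_inter, Finset.inter_eq_right.2 hB]
  | limit ξ h1 hξ ih =>
    rw [hα.schreier_limit h1 hξ] at *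
    obtain ⟨n, hn, hA⟩ := hA
    exact ⟨n, fun a ha => hn a (hB ha), ih n hA hB⟩

theorem empty_mem_schreier (hα : IsApproximating α) {ξ : Ordinal.{0}} (h1 : ξ < ω₁) :
    ∅ ∈ schreier α ξ :=
  mem_schreier_of_subset hα h1 (singleton_mem_schreier hα h1 1) (Finset.empty_subset _)

/-- Spreading: moving points to the right while keeping their order preserves membership. A
decomposition of the image pulls back along `ψ`, and the bounds on the number of blocks only become
weaker. -/
theorem mem_schreier_of_strictMonoOn (hα : IsApproximating α) {ξ : Ordinal.{0}} (h1 : ξ < ω₁)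
    {X : Finset ℕ+} {ψ : ℕ+ → ℕ+} (hψ : StrictMonoOn ψ X) (hle : ∀ x ∈ X, ψ x ≤ x)
    (hX : X.image ψ ∈ schreier α ξ) : X ∈ schreier α ξ := by
  induction ξ, h1 using hα.induction generalizing X with
  | zero _ =>
    rw [schreier_zero] at *
    change (X.image ψ).card ≤ 1 at hX
    rwa [Finset.card_image_of_injOn hψ.injOn] at hX
  | succ γ hγ ih _ =>
    rw [schreier_add_one] at *
    obtain ⟨ρ, hm, -, hf, hc⟩ :=
      exists_monotoneOn_of_mem_schreierSucc (empty_mem_schreier hα hγ) hX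
    refine mem_schreierSucc_of_monotoneOn (ρ := ρ ∘ ψ) ?_ ?_ ?_
    · intro x hx y hy hxy
      exact hm (Finset.mem_coe.2 (Finset.mem_image_of_mem _ hx))
        (Finset.mem_coe.2 (Finset.mem_image_of_mem _ hy)) (hψ.monotoneOn hx hy hxy)
    · intro p
      have hs : ((X.filter fun x => (ρ ∘ ψ) x = p : Finset ℕ+) : Set ℕ+) ⊆ X := by
        rw [Finset.coe_filter]
        exact fun x hx => hx.1
      refine ih (hψ.mono hs) (fun x hx => hle x (hs hx)) ?_
      convert hf p using 1
      rw [Finset.filter_image]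
      rfl
    · intro a ha
      rw [← Finset.image_image]
      exact (hc _ (Finset.mem_image_of_mem _ ha)).trans (hle a ha)
  | limit ξ h1 hξ ih =>
    rw [hα.schreier_limit h1 hξ] at *
    obtain ⟨n, hn, hX⟩ := hX
    exact ⟨n, fun a ha => (hn _ (Finset.mem_image_of_mem _ ha)).trans (hle a ha), ih n hψ hle hX⟩

/-- The largest element of a set in a Schreier family may be decreased. -/
theorem insert_mem_schreier (hα : IsApproximating α) {ξ : Ordinal.{0}} (h1 : ξ < ω₁)
    {A : Finset ℕ+} {b c : ℕ+} (hb : ∀ a ∈ A, a < b) (hbc : b ≤ c)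
    (hA : insert c A ∈ schreier α ξ) : insert b A ∈ schreier α ξ := by
  rcases A.eq_empty_or_nonempty with rfl | ⟨a₀, ha₀⟩
  · exact singleton_mem_schreier hα h1 b
  induction ξ, h1 using hα.induction generalizing A a₀ with
  | zero _ =>
    exfalso
    rw [schreier_zero] at hA
    change (insert c A).card ≤ 1 at hA
    rw [Finset.card_insert_of_notMem fun h => absurd (hb c h) (not_lt.2 hbc)] at hA
    have := Finset.card_pos.2 ⟨a₀, ha₀⟩
    omega
  | succ γ hγ ih _ =>
    rw [schreier_add_one] at *
    obtain ⟨ρ, hm, -, hf, hc⟩ :=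
      exists_monotoneOn_of_mem_schreierSucc (empty_mem_schreier hα hγ) hA
    have hbA : b ∉ A := fun h => lt_irrefl _ (hb b h)
    have hcA : c ∉ A := fun h => absurd (hb c h) (not_lt.2 hbc)
    -- The point `b` takes over the label of `c`; the set of labels is unchanged.
    have hup : ∀ a ∈ A, Function.update ρ b (ρ c) a = ρ a := fun a ha =>
      Function.update_of_ne (by rintro rfl; exact hbA ha) _ _
    have him : (insert b A).image (Function.update ρ b (ρ c)) = (insert c A).image ρ := by
      rw [Finset.image_insert, Finset.image_insert, Function.update_self]
      congr 1
      exact Finset.image_congr hup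
    refine mem_schreierSucc_of_monotoneOn (ρ := Function.update ρ b (ρ c)) ?_ ?_ ?_
    · intro x hx y hy hxy
      simp only [Finset.coe_insert, Set.mem_insert_iff, Finset.mem_coe] at hx hy
      rcases hx with rfl | hx <;> rcases hy with rfl | hy
      · rfl
      · exact absurd (hb y hy) (not_lt.2 hxy)
      · rw [hup x hx, Function.update_self]
        exact hm (by simp [hx]) (by simp) ((hb x hx).le.trans hbc)
      · rw [hup x hx, hup y hy]
        exact hm (by simp [hx]) (by simp [hy]) hxy
    · intro p
      have hAp : A.filter (fun a => Function.update ρ b (ρ c) a = p) = A.filter (ρ · = p) :=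
        Finset.filter_congr fun a ha => by rw [hup a ha]
      have hp := hf p
      rw [Finset.filter_insert] at hp ⊢
      rw [Function.update_self, hAp]
      split_ifs at hp ⊢ with h
      · rcases (A.filter (ρ · = p)).eq_empty_or_nonempty with he | ⟨a₁, ha₁⟩
        · rw [he]
          exact singleton_mem_schreier hα hγ b
        · exact ih (fun a ha => hb a (Finset.mem_filter.1 ha).1) hp a₁ ha₁
      · exact hp
    · intro a ha
      rw [him]
      rcases Finset.mem_insert.1 ha with rfl | ha
      -- Here `A` must be nonempty: a point `a₀ < b` bounds the number of blocks, which `b ≤ c`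
      -- alone would not do.
      · exact (hc a₀ (by simp [ha₀])).trans (PNat.coe_le_coe _ _ |>.2 (hb a₀ ha₀).le)
      · exact hc a (by simp [ha])
  | limit ξ h1 hξ ih =>
    rw [hα.schreier_limit h1 hξ] at *
    obtain ⟨n, hn, hA⟩ := hA
    refine ⟨n, fun a ha => ?_, ih n hb hA a₀ ha₀⟩
    rcases Finset.mem_insert.1 ha with rfl | ha
    · exact (hn a₀ (by simp [ha₀])).trans (hb a₀ ha₀).le
    · exact hn a (by simp [ha])

end

/-! ### Rearranging disjoint members of a family into consecutive ones -/

/-- Two disjoint members of `ℱ` that are not in the order of their minima can be replaced by two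
disjoint members with the same union, the second of which starts later. -/
def Exchangeable (ℱ : Set (Finset ℕ+)) : Prop :=
  ∀ (B₁ B₂ : Finset ℕ+) (c e : ℕ+), B₁ ∈ ℱ → B₂ ∈ ℱ → Disjoint B₁ B₂ → c ∈ B₂ →
    (∀ y ∈ B₂, c ≤ y) → e ∈ B₁ → c < e →
    ∃ C₁ ∈ ℱ, ∃ C₂ ∈ ℱ, C₁ ∪ C₂ = B₁ ∪ B₂ ∧ Disjoint C₁ C₂ ∧ ∀ y ∈ C₂, c < y

/-- A partition into members of `ℱ`, given as the fibers of a function `π` with `π x ≤ x`, can be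
replaced by a partition into consecutive members of `ℱ` with values among those of `π`. -/
def Reorderable (ℱ : Set (Finset ℕ+)) : Prop :=
  ∀ (X : Finset ℕ+) (π : ℕ+ → ℕ+), (∀ x ∈ X, π x ≤ x) → (∀ p, X.filter (π · = p) ∈ ℱ) →
    ∃ ρ : ℕ+ → ℕ+, MonotoneOn ρ X ∧ (∀ x ∈ X, ρ x ≤ x) ∧ (∀ x ∈ X, ρ x ∈ X.image π) ∧
      ∀ p, X.filter (ρ · = p) ∈ ℱ

/-- Among the finitely many valid labellings with values in `X.image π`, the lexicographically least
one is monotone. At an inversion `x < y`, `ρ y < ρ x`, an exchange between the two fibers gives the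
smaller label to the minimum `c` of the fiber of `x` and changes nothing before `c`, which
contradicts minimality. -/
theorem Exchangeable.reorderable {ℱ : Set (Finset ℕ+)} (hℱ : Exchangeable ℱ) :
    Reorderable ℱ := by
  classical
  intro X π hπ hf
  -- Labellings live on the finite set `X`, so that a minimum exists; they are extended by 1 in
  -- order to be compared lexicographically on `ℕ+`.
  let ext : (X → X.image π) → ℕ+ → ℕ+ := fun g x => if h : x ∈ X then g ⟨x, h⟩ else 1
  have ext_apply : ∀ g x (h : x ∈ X), ext g x = g ⟨x, h⟩ := fun g x h => dif_pos h
  let s : Set (X → X.image π) :=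
    {g | (∀ x ∈ X, ext g x ≤ x) ∧ ∀ p, X.filter (ext g · = p) ∈ ℱ}
  have mem_s : ∀ ρ : ℕ+ → ℕ+, (∀ x ∈ X, ρ x ≤ x) → (∀ p, X.filter (ρ · = p) ∈ ℱ) →
      (∀ x ∈ X, ρ x ∈ X.image π) → ∃ g ∈ s, ∀ x ∈ X, ext g x = ρ x := by
    intro ρ h1 h2 h3
    have he : ∀ x ∈ X, ext (fun x => ⟨ρ x, h3 x x.2⟩) x = ρ x := fun x hx =>
      ext_apply (fun x => ⟨ρ x, h3 x x.2⟩) x hx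
    refine ⟨fun x => ⟨ρ x, h3 x x.2⟩, ⟨fun x hx => by rw [he x hx]; exact h1 x hx, fun p => ?_⟩, he⟩
    convert h2 p using 1
    exact Finset.filter_congr fun x hx => by rw [he x hx]
  have hne : s.Nonempty := by
    obtain ⟨g, hg, -⟩ := mem_s π hπ hf fun x hx => Finset.mem_image_of_mem _ hx
    exact ⟨g, hg⟩
  obtain ⟨g, hg, hmin⟩ := Set.exists_min_image s (fun g => toLex (ext g)) (Set.toFinite s) hne
  have hmem : ∀ x ∈ X, ext g x ∈ X.image π := fun x hx => by
    rw [ext_apply g x hx]; exact (g ⟨x, hx⟩).2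
  refine ⟨ext g, ?_, hg.1, hmem, hg.2⟩
  intro x hx y hy hxy
  by_contra hlt
  rw [not_le] at hlt
  set ρ := ext g
  have hxne : x ≠ y := by rintro rfl; exact lt_irrefl _ hlt
  have hx2 : x ∈ X.filter (ρ · = ρ x) := Finset.mem_filter.2 ⟨hx, rfl⟩
  set c := (X.filter (ρ · = ρ x)).min' ⟨x, hx2⟩ with hc
  have hc2 : c ∈ X.filter (ρ · = ρ x) := Finset.min'_mem _ _
  have hcx : c ≤ x := Finset.min'_le _ _ hx2
  have hdisj : Disjoint (X.filter (ρ · = ρ y)) (X.filter (ρ · = ρ x)) := by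
    rw [Finset.disjoint_left]
    intro z hz hz'
    rw [Finset.mem_filter] at hz hz'
    exact hlt.ne (hz.2.symm.trans hz'.2)
  obtain ⟨C₁, hC₁, C₂, hC₂, hU, hd, hgt⟩ := hℱ (X.filter (ρ · = ρ y)) (X.filter (ρ · = ρ x)) c y
    (hg.2 _) (hg.2 _) hdisj hc2 (fun z hz => Finset.min'_le _ _ hz)
    (Finset.mem_filter.2 ⟨hy, rfl⟩) (hcx.trans_lt (lt_of_le_of_ne hxy hxne))
  have hU' : ∀ z, z ∈ C₁ ∨ z ∈ C₂ ↔ z ∈ X ∧ (ρ z = ρ y ∨ ρ z = ρ x) := by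
    intro z
    rw [← Finset.mem_union, hU]
    simp only [Finset.mem_union, Finset.mem_filter]
    tauto
  have hcC : c ∈ C₁ := by
    have hcX := Finset.mem_filter.1 hc2
    rcases (hU' c).2 ⟨hcX.1, Or.inr hcX.2⟩ with h | h
    · exact h
    · exact absurd (hgt c h) (lt_irrefl _)
  have hcρ : ρ x ≤ c := by
    have hcX := Finset.mem_filter.1 hc2
    rw [← hcX.2]
    exact hg.1 c hcX.1
  -- The requirement `label ≤ point` survives: `ρ y < ρ x` settles `C₁`, and on `C₂` the label `ρ x
  -- ≤ c` lies below every point because `C₂` starts after `c`.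
  let ρ' : ℕ+ → ℕ+ := fun z => if z ∈ C₁ then ρ y else if z ∈ C₂ then ρ x else ρ z
  have h₁ : ∀ z ∈ C₁, ρ' z = ρ y := fun z hz => if_pos hz
  have h₂ : ∀ z ∈ C₂, ρ' z = ρ x := fun z hz => by
    have : z ∉ C₁ := fun h => Finset.disjoint_left.1 hd h hz
    simp only [ρ', if_neg this, if_pos hz]
  have h₃ : ∀ z, z ∉ C₁ → z ∉ C₂ → ρ' z = ρ z := fun z hz hz' => by
    simp only [ρ', if_neg hz, if_neg hz']
  obtain ⟨g', hg', he⟩ := mem_s ρ' (by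
      intro z hz
      by_cases hz1 : z ∈ C₁
      · rw [h₁ z hz1]
        rcases ((hU' z).1 (Or.inl hz1)).2 with h | h
        · rw [← h]; exact hg.1 z hz
        · exact hlt.le.trans (h ▸ hg.1 z hz)
      by_cases hz2 : z ∈ C₂
      · rw [h₂ z hz2]
        exact hcρ.trans (hgt z hz2).le
      · rw [h₃ z hz1 hz2]; exact hg.1 z hz) (by
      intro p
      by_cases hp1 : p = ρ y
      · convert hC₁ using 1
        ext z
        rw [Finset.mem_filter]
        constructor
        · rintro ⟨hz, hzp⟩
          by_contra hz1
          by_cases hz2 : z ∈ C₂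
          · rw [h₂ z hz2, hp1] at hzp
            exact hlt.ne hzp.symm
          · rw [h₃ z hz1 hz2, hp1] at hzp
            exact ((hU' z).2 ⟨hz, Or.inl hzp⟩).elim hz1 hz2
        · intro hz
          exact ⟨((hU' z).1 (Or.inl hz)).1, (h₁ z hz).trans hp1.symm⟩
      by_cases hp2 : p = ρ x
      · convert hC₂ using 1
        ext z
        rw [Finset.mem_filter]
        constructor
        · rintro ⟨hz, hzp⟩
          by_contra hz2
          by_cases hz1 : z ∈ C₁
          · rw [h₁ z hz1, hp2] at hzp
            exact hlt.ne hzp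
          · rw [h₃ z hz1 hz2, hp2] at hzp
            exact ((hU' z).2 ⟨hz, Or.inr hzp⟩).elim hz1 hz2
        · intro hz
          exact ⟨((hU' z).1 (Or.inr hz)).1, (h₂ z hz).trans hp2.symm⟩
      · convert hg.2 p using 1
        refine Finset.filter_congr fun z hz => ?_
        change ρ' z = p ↔ ρ z = p
        by_cases hz1 : z ∈ C₁
        · rw [h₁ z hz1]
          rcases ((hU' z).1 (Or.inl hz1)).2 with h | h <;> rw [h]
          exact ⟨fun h => absurd h.symm hp1, fun h => absurd h.symm hp2⟩
        by_cases hz2 : z ∈ C₂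
        · rw [h₂ z hz2]
          rcases ((hU' z).1 (Or.inr hz2)).2 with h | h <;> rw [h]
          exact ⟨fun h => absurd h.symm hp2, fun h => absurd h.symm hp1⟩
        · rw [h₃ z hz1 hz2]) (by
      intro z hz
      by_cases hz1 : z ∈ C₁
      · rw [h₁ z hz1]; exact hmem y hy
      by_cases hz2 : z ∈ C₂
      · rw [h₂ z hz2]; exact hmem x hx
      · rw [h₃ z hz1 hz2]; exact hmem z hz)
  refine absurd (hmin g' hg') (not_le.2 ?_)
  refine ⟨c, ?_, ?_⟩
  · intro z hz
    change ext g' z = ρ z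
    by_cases hzX : z ∈ X
    · rw [he z hzX]
      by_cases hz1 : z ∈ C₁
      · rw [h₁ z hz1]
        rcases ((hU' z).1 (Or.inl hz1)).2 with h | h
        · exact h.symm
        · exact absurd (Finset.min'_le _ _ (Finset.mem_filter.2 ⟨hzX, h⟩)) (not_le.2 hz)
      by_cases hz2 : z ∈ C₂
      · exact absurd (hgt z hz2) (not_lt.2 hz.le)
      · exact h₃ z hz1 hz2
    · change (if h : z ∈ X then _ else _) = (if h : z ∈ X then _ else _)
      rw [dif_neg hzX, dif_neg hzX]
  · change ext g' c < ρ c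
    have hcX := Finset.mem_filter.1 hc2
    rw [he c hcX.1, h₁ c hcC, hcX.2]
    exact hlt

/-- A finite set splits into two consecutive pieces, the first with a given number of elements. -/
theorem exists_initial_segment (Q : Finset ℕ+) {n : ℕ} (hn : n ≤ Q.card) :
    ∃ Q₁ ⊆ Q, Q₁.card = n ∧ Before Q₁ (Q \ Q₁) := by
  induction n with
  | zero => exact ⟨∅, by simp, rfl, by simp [Before]⟩
  | succ n ih =>
    obtain ⟨Q₁, hQ, hc, hb⟩ := ih (by omega)
    have hne : (Q \ Q₁).Nonempty := by
      rw [← Finset.card_pos, Finset.card_sdiff_of_subset hQ]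
      omega
    have hm := Finset.mem_sdiff.1 (Finset.min'_mem _ hne)
    refine ⟨insert ((Q \ Q₁).min' hne) Q₁, Finset.insert_subset hm.1 hQ, ?_, ?_⟩
    · rw [Finset.card_insert_of_notMem hm.2, hc]
    · intro a ha b hbm
      rw [Finset.mem_sdiff, Finset.mem_insert, not_or] at hbm
      have hb' : b ∈ Q \ Q₁ := Finset.mem_sdiff.2 ⟨hbm.1, hbm.2.2⟩
      rcases Finset.mem_insert.1 ha with rfl | ha
      · exact lt_of_le_of_ne (Finset.min'_le _ _ hb') (Ne.symm hbm.2.1)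
      · exact hb a ha b hb'

/-! ### The exchange property of Schreier families, and division into two members -/

section

variable {α : Ordinal.{0} → ℕ+ → Ordinal.{0}}

theorem exchangeable_schreier_zero : Exchangeable (schreier α 0) := by
  intro B₁ B₂ c e h₁ h₂ hd hc hmin he hce
  refine ⟨B₂, h₂, B₁, h₁, Finset.union_comm _ _, hd.symm, ?_⟩
  intro y hy
  rw [schreier_zero] at h₁
  rwa [Finset.card_le_one.1 h₁ y hy e he]

/-- Split `B₁` and `B₂` into blocks from `𝒮_γ`, reorder all blocks into consecutive ones, and give
the first of them to `C₁`, as many as `B₁` had. At most as many as `B₂` had remain, and they start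
no earlier than `c`. -/
theorem exchangeable_schreier_add_one (hα : IsApproximating α) {γ : Ordinal.{0}} (hγ : γ < ω₁)
    (hγ1 : γ + 1 < ω₁) (hR : Reorderable (schreier α γ)) :
    Exchangeable (schreier α (γ + 1)) := by
  classical
  intro B₁ B₂ c e h₁ h₂ hd hc hmin he hce
  by_cases hbc : ∀ y ∈ B₁, c < y
  · exact ⟨B₂, h₂, B₁, h₁, Finset.union_comm _ _, hd.symm, hbc⟩
  push Not at hbc
  obtain ⟨b, hb, hbc⟩ := hbc
  have hbc : b < c := lt_of_le_of_ne hbc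
    (by rintro rfl; exact Finset.disjoint_left.1 hd hb hc)
  -- Consecutive sets with `c ≤ C₂` are enough. If `c ∈ C₂`, it is moved to `C₁`: the set `C₁` lies
  -- below `c = min B₂`, hence inside `B₁`, and `insert c C₁` arises from `insert e C₁ ⊆ B₁` by
  -- decreasing the largest element.
  suffices h : ∃ C₁ ∈ schreier α (γ + 1), ∃ C₂ ∈ schreier α (γ + 1), C₁ ∪ C₂ = B₁ ∪ B₂ ∧
      Before C₁ C₂ ∧ ∀ y ∈ C₂, c ≤ y by
    obtain ⟨C₁, hC₁, C₂, hC₂, hU, hB, hle⟩ := h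
    have hdC : Disjoint C₁ C₂ := Finset.disjoint_left.2 fun z hz hz' =>
      lt_irrefl z (hB z hz z hz')
    by_cases hcC : c ∈ C₂
    · have hC₁' : insert c C₁ ∈ schreier α (γ + 1) := by
        refine insert_mem_schreier hα hγ1 (fun a ha => hB a ha c hcC) hce.le
          (mem_schreier_of_subset hα hγ1 h₁ ?_)
        refine Finset.insert_subset he fun a ha => ?_
        have : a ∈ B₁ ∪ B₂ := hU ▸ Finset.mem_union_left _ ha
        refine (Finset.mem_union.1 this).resolve_right fun ha2 => ?_
        exact absurd (hmin a ha2) (not_le.2 (hB a ha c hcC))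
      refine ⟨_, hC₁', C₂.erase c, mem_schreier_of_subset hα hγ1 hC₂ (Finset.erase_subset _ _),
        ?_, ?_, ?_⟩
      · rw [← hU]
        ext z
        simp only [Finset.mem_union, Finset.mem_insert, Finset.mem_erase]
        by_cases hz : z = c
        · subst hz; simp [hcC]
        · simp [hz]
      · rw [Finset.disjoint_left]
        intro z hz hz'
        rw [Finset.mem_erase] at hz'
        exact Finset.disjoint_left.1 hdC ((Finset.mem_insert.1 hz).resolve_left hz'.1) hz'.2
      · intro y hy
        rw [Finset.mem_erase] at hy
        exact lt_of_le_of_ne (hle y hy.2) (Ne.symm hy.1)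
    · refine ⟨C₁, hC₁, C₂, hC₂, hU, hdC, fun y hy => lt_of_le_of_ne (hle y hy) ?_⟩
      rintro rfl
      exact hcC hy
  rw [schreier_add_one] at *
  have h0 := empty_mem_schreier hα hγ
  obtain ⟨ρ₁, hm₁, hr₁, hf₁, hc₁⟩ := exists_monotoneOn_of_mem_schreierSucc h0 h₁
  obtain ⟨ρ₂, hm₂, hr₂, hf₂, hc₂⟩ := exists_monotoneOn_of_mem_schreierSucc h0 h₂
  let π : ℕ+ → ℕ+ := fun x => if x ∈ B₁ then ρ₁ x else ρ₂ x
  have hπ₁ : ∀ x ∈ B₁, π x = ρ₁ x := fun x hx => if_pos hx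
  have hπ₂ : ∀ x ∈ B₂, π x = ρ₂ x := fun x hx =>
    if_neg fun h => Finset.disjoint_left.1 hd h hx
  obtain ⟨ρ, hm, hle, hQ, hf⟩ := hR (B₁ ∪ B₂) π (by
      intro x hx
      rcases Finset.mem_union.1 hx with h | h
      · rw [hπ₁ x h]; exact (hr₁ x h).2
      · rw [hπ₂ x h]; exact (hr₂ x h).2) (by
      intro p
      by_cases hp : p ∈ B₁
      · refine mem_schreier_of_subset hα hγ (hf₁ p) fun x hx => ?_
        rw [Finset.mem_filter, Finset.mem_union] at hx
        rw [Finset.mem_filter]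
        have hx1 : x ∈ B₁ := by
          refine hx.1.resolve_right fun h => ?_
          rw [hπ₂ x h] at hx
          exact Finset.disjoint_left.1 hd hp (hx.2 ▸ (hr₂ x h).1)
        exact ⟨hx1, hπ₁ x hx1 ▸ hx.2⟩
      · refine mem_schreier_of_subset hα hγ (hf₂ p) fun x hx => ?_
        rw [Finset.mem_filter, Finset.mem_union] at hx
        rw [Finset.mem_filter]
        have hx2 : x ∈ B₂ := by
          refine hx.1.resolve_left fun h => ?_
          rw [hπ₁ x h] at hx
          exact hp (hx.2 ▸ (hr₁ x h).1)
        exact ⟨hx2, hπ₂ x hx2 ▸ hx.2⟩)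
  set Q := (B₁ ∪ B₂).image π
  have hQU : Q ⊆ B₁.image ρ₁ ∪ B₂.image ρ₂ := by
    intro q hq
    obtain ⟨x, hx, rfl⟩ := Finset.mem_image.1 hq
    rcases Finset.mem_union.1 hx with h | h
    · rw [hπ₁ x h]; exact Finset.mem_union_left _ (Finset.mem_image_of_mem _ h)
    · rw [hπ₂ x h]; exact Finset.mem_union_right _ (Finset.mem_image_of_mem _ h)
  have hn : (B₁.image ρ₁).card ≤ Q.card := by
    refine Finset.card_le_card fun q hq => ?_
    obtain ⟨x, hx, rfl⟩ := Finset.mem_image.1 hq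
    exact Finset.mem_image.2 ⟨x, Finset.mem_union_left _ hx, hπ₁ x hx⟩
  obtain ⟨Q₁, hQ₁, hcard, hbefore⟩ := exists_initial_segment Q hn
  -- Labels below `c` come from `B₁`. A remaining label below `c` would, together with all of `Q₁`,
  -- give one label more than `B₁` has.
  have hcQ : ∀ q ∈ Q \ Q₁, c ≤ q := by
    intro q hq
    by_contra hqc
    rw [not_le] at hqc
    have hsub : insert q Q₁ ⊆ B₁.image ρ₁ := by
      intro r hr
      have hrQ : r ∈ Q := by
        rcases Finset.mem_insert.1 hr with rfl | hr
        · exact (Finset.mem_sdiff.1 hq).1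
        · exact hQ₁ hr
      have hrc : r < c := by
        rcases Finset.mem_insert.1 hr with rfl | hr
        · exact hqc
        · exact (hbefore r hr q hq).trans hqc
      refine (Finset.mem_union.1 (hQU hrQ)).resolve_right fun h => ?_
      obtain ⟨x, hx, rfl⟩ := Finset.mem_image.1 h
      exact absurd (hmin _ (hr₂ x hx).1) (not_le.2 hrc)
    have := Finset.card_le_card hsub
    rw [Finset.card_insert_of_notMem (Finset.mem_sdiff.1 hq).2, hcard] at this
    omega
  have hge : ∀ y ∈ (B₁ ∪ B₂).filter (fun x => ρ x ∉ Q₁), c ≤ y := by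
    intro y hy
    rw [Finset.mem_filter] at hy
    exact (hcQ _ (Finset.mem_sdiff.2 ⟨hQ y hy.1, hy.2⟩)).trans (hle y hy.1)
  have hfil : ∀ (P : ℕ+ → Prop) [DecidablePred P] (p : ℕ+),
      ((B₁ ∪ B₂).filter P).filter (ρ · = p) ∈ schreier α γ := by
    intro P _ p
    exact mem_schreier_of_subset hα hγ (hf p)
      (Finset.filter_subset_filter _ (Finset.filter_subset _ _))
  refine ⟨(B₁ ∪ B₂).filter (fun x => ρ x ∈ Q₁), ?_, (B₁ ∪ B₂).filter (fun x => ρ x ∉ Q₁), ?_,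
    Finset.filter_union_filter_not_eq _ _, ?_, hge⟩
  · refine mem_schreierSucc_of_monotoneOn (ρ := ρ) (hm.mono ?_) (hfil _) ?_
    · exact Finset.coe_subset.2 (Finset.filter_subset _ _)
    · intro a ha
      have h1 : (((B₁ ∪ B₂).filter (fun x => ρ x ∈ Q₁)).image ρ).card ≤ (B₁.image ρ₁).card := by
        rw [← hcard]
        refine Finset.card_le_card fun q hq => ?_
        obtain ⟨x, hx, rfl⟩ := Finset.mem_image.1 hq
        exact (Finset.mem_filter.1 hx).2
      refine h1.trans ?_
      rcases Finset.mem_union.1 (Finset.mem_filter.1 ha).1 with h | h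
      · exact hc₁ a h
      · exact (hc₁ b hb).trans (PNat.coe_le_coe _ _ |>.2 (hbc.le.trans (hmin a h)))
  · refine mem_schreierSucc_of_monotoneOn (ρ := ρ) (hm.mono ?_) (hfil _) ?_
    · exact Finset.coe_subset.2 (Finset.filter_subset _ _)
    · intro a ha
      have h1 : (((B₁ ∪ B₂).filter (fun x => ρ x ∉ Q₁)).image ρ).card ≤ (Q \ Q₁).card := by
        refine Finset.card_le_card fun q hq => ?_
        obtain ⟨x, hx, rfl⟩ := Finset.mem_image.1 hq
        rw [Finset.mem_filter] at hx
        exact Finset.mem_sdiff.2 ⟨hQ x hx.1, hx.2⟩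
      have h2 : (Q \ Q₁).card ≤ (B₂.image ρ₂).card := by
        rw [Finset.card_sdiff_of_subset hQ₁, hcard]
        have := (Finset.card_le_card hQU).trans (Finset.card_union_le _ _)
        omega
      exact h1.trans (h2.trans ((hc₂ c hc).trans (PNat.coe_le_coe _ _ |>.2 (hge a ha))))
  · intro x hx y hy
    rw [Finset.mem_filter] at hx hy
    by_contra hxy
    have h1 := hm (Finset.mem_coe.2 hy.1) (Finset.mem_coe.2 hx.1) (not_lt.1 hxy)
    exact absurd (hbefore _ hx.2 _ (Finset.mem_sdiff.2 ⟨hQ y hy.1, hy.2⟩)) (not_lt.2 h1)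

/-- The union condition on `α` with `B = ∅` makes the approximating families increase on sets that
avoid 1. -/
theorem mem_schreier_approx_of_le (hα : IsApproximating α) {ξ : Ordinal.{0}} (h1 : ξ < ω₁)
    (hξ : Order.IsSuccLimit ξ) {n m : ℕ+} (hnm : n ≤ m) {A : Finset ℕ+}
    (hA1 : ∀ a ∈ A, 1 < a) (hA : A ∈ schreier α (α ξ n)) : A ∈ schreier α (α ξ m) := by
  induction m using PNat.recOn with
  | one => rwa [le_antisymm hnm (one_le)] at hA
  | succ m ih =>
    rcases hnm.eq_or_lt with rfl | h
    · exact hA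
    · have := hα.union ξ h1 hξ m A ∅ (ih (PNat.lt_add_one_iff.1 h))
        (empty_mem_schreier hα ((hα.lt h1 hξ m).trans h1)) hA1 (by simp) (by simp [Before])
      rwa [Finset.union_empty] at this

theorem mem_schreier_one_iff {A : Finset ℕ+} :
    A ∈ schreier α 1 ↔ ∀ a ∈ A, A.card ≤ (a : ℕ) := by
  rw [← zero_add (1 : Ordinal.{0}), schreier_add_one, schreier_zero]
  constructor
  · rintro ⟨n, E, hE, hn, hb, rfl⟩ a ha
    simp only [Finset.mem_biUnion, Finset.mem_univ, true_and] at ha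
    obtain ⟨i, hi⟩ := ha
    refine le_trans ?_ (hn i a hi)
    refine Finset.card_biUnion_le.trans ((Finset.sum_le_sum fun i _ => hE i).trans ?_)
    simp
  · intro h
    refine mem_schreierSucc_of_monotoneOn (ρ := id) monotoneOn_id ?_ (by simpa using h)
    intro p
    refine Finset.card_le_one.2 fun x hx y hy => ?_
    exact (Finset.mem_filter.1 hx).2.trans (Finset.mem_filter.1 hy).2.symm

/-- Both sets lie in the family of index `α ξ c`. Their points beyond `c` form two members, which
are made consecutive by reordering; the union condition then puts them into the family of index `α ξ
(c + 1)`, and they are all at least `c + 1`. The points up to `c` are those of `B₁` below `c`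
together with `c`, which replaces `e`. -/
theorem exchangeable_schreier_limit (hα : IsApproximating α) {ξ : Ordinal.{0}} (h1 : ξ < ω₁)
    (hξ : Order.IsSuccLimit ξ) (hR : ∀ n, Reorderable (schreier α (α ξ n))) :
    Exchangeable (schreier α ξ) := by
  classical
  intro B₁ B₂ c e h₁ h₂ hd hc hmin he hce
  by_cases hbc : ∀ y ∈ B₁, c < y
  · exact ⟨B₂, h₂, B₁, h₁, Finset.union_comm _ _, hd.symm, hbc⟩
  push Not at hbc
  obtain ⟨b, hb, hbc⟩ := hbc
  have hbc : b < c := lt_of_le_of_ne hbc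
    (by rintro rfl; exact Finset.disjoint_left.1 hd hb hc)
  have hn := fun n => (hα.lt h1 hξ n).trans h1
  have h₁' := h₁
  rw [hα.schreier_limit h1 hξ] at h₁' h₂
  obtain ⟨n₁, hn₁, h₁'⟩ := h₁'
  obtain ⟨n₂, hn₂, h₂⟩ := h₂
  have hB₁ : ∀ a ∈ B₁, 1 < a := by
    intro a ha
    by_contra h
    obtain rfl : a = 1 := le_antisymm (not_lt.1 h) (one_le)
    -- This is where `α ξ 1 = 1` matters: a member of `𝒮_1` that contains 1 is a singleton, whereas
    -- `B₁` contains `b < e`.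
    obtain rfl : n₁ = 1 := le_antisymm (hn₁ 1 ha) (one_le)
    rw [hα.one ξ h1 hξ, mem_schreier_one_iff] at h₁'
    have h2 := Finset.card_le_one.1 (h₁' 1 ha)
    exact absurd (h2 e he b hb) (hbc.trans hce).ne'
  have hB₂ : ∀ a ∈ B₂, 1 < a := fun a ha => (hB₁ b hb).trans (hbc.trans_le (hmin a ha))
  have k₁ := mem_schreier_approx_of_le hα h1 hξ ((hn₁ b hb).trans hbc.le) hB₁ h₁'
  have k₂ := mem_schreier_approx_of_le hα h1 hξ (hn₂ c hc) hB₂ h₂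
  have hC₁ : insert c (B₁.filter (· < c)) ∈ schreier α ξ := by
    refine insert_mem_schreier hα h1 (fun a ha => (Finset.mem_filter.1 ha).2) hce.le
      (mem_schreier_of_subset hα h1 h₁ ?_)
    exact Finset.insert_subset he (Finset.filter_subset _ _)
  set X := (B₁ ∪ B₂).filter (c < ·) with hX
  -- Two arbitrary labels; they do not exceed the points of `X`, which are at least 2.
  let π : ℕ+ → ℕ+ := fun x => if x ∈ B₁ then 1 else 2
  have hX2 : ∀ x ∈ X, 2 ≤ x := by
    intro x hx
    have hc1 : 1 < c := hB₂ c hc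
    exact (PNat.add_one_le_iff.2 hc1).trans (Finset.mem_filter.1 hx).2.le
  obtain ⟨ρ, hm, hle, hQ, hf⟩ := hR c X π (by
      intro x hx
      have := hX2 x hx
      by_cases h : x ∈ B₁
      · simp only [π, if_pos h]; exact one_le
      · simpa only [π, if_neg h] using this) (by
      intro p
      by_cases hp : p = 1
      · refine mem_schreier_of_subset hα (hn c) k₁ fun x hx => ?_
        by_contra h
        have := (Finset.mem_filter.1 hx).2
        simp only [π, if_neg h, hp] at this
        exact absurd this (by decide)
      · refine mem_schreier_of_subset hα (hn c) k₂ fun x hx => ?_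
        have hx' := Finset.mem_filter.1 hx
        refine (Finset.mem_union.1 (Finset.mem_filter.1 hx'.1).1).resolve_left fun h => ?_
        have := hx'.2
        simp only [π, if_pos h] at this
        exact hp this.symm)
  have hρ : ∀ x ∈ X, ρ x = 1 ∨ ρ x = 2 := by
    intro x hx
    obtain ⟨y, -, hy⟩ := Finset.mem_image.1 (hQ x hx)
    rw [← hy]
    by_cases h : y ∈ B₁ <;> simp [π, h]
  have hX12 : X.filter (ρ · = 1) ∪ X.filter (ρ · = 2) = X := by
    rw [← Finset.filter_or]
    exact Finset.filter_true_of_mem hρ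
  have h12 : (1 : ℕ+) < 2 := by decide
  have hXmem : X ∈ schreier α (α ξ (c + 1)) := by
    rw [← hX12]
    refine hα.union ξ h1 hξ c _ _ (hf 1) (hf 2) ?_ ?_ (before_fiber hm h12) <;>
    · intro a ha
      exact h12.trans_le (hX2 a (Finset.mem_filter.1 ha).1)
  refine ⟨_, hC₁, X, ?_, ?_, ?_, fun y hy => (Finset.mem_filter.1 hy).2⟩
  · rw [hα.schreier_limit h1 hξ]
    exact ⟨c + 1, fun a ha => PNat.add_one_le_iff.2 (Finset.mem_filter.1 ha).2, hXmem⟩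
  · ext z
    simp only [hX, Finset.mem_union, Finset.mem_insert, Finset.mem_filter]
    constructor
    · rintro ((rfl | h) | h)
      · exact Or.inr hc
      · exact Or.inl h.1
      · exact h.1
    · intro h
      rcases lt_trichotomy z c with hz | hz | hz
      · refine Or.inl (Or.inr ⟨h.resolve_right fun h2 => ?_, hz⟩)
        exact absurd (hmin z h2) (not_le.2 hz)
      · exact Or.inl (Or.inl hz)
      · exact Or.inr ⟨h, hz⟩
  · rw [Finset.disjoint_left]
    intro z hz hz'
    have h2 := (Finset.mem_filter.1 hz').2
    rcases Finset.mem_insert.1 hz with rfl | hz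
    · exact lt_irrefl _ h2
    · exact lt_asymm h2 (Finset.mem_filter.1 hz).2

/-- Transfinite induction that passes through the exchange property: reordering at smaller indices
gives exchange at `ξ`, and exchange at `ξ` gives reordering at `ξ`. -/
theorem reorderable_schreier (hα : IsApproximating α) {ξ : Ordinal.{0}} (h1 : ξ < ω₁) :
    Reorderable (schreier α ξ) := by
  induction ξ, h1 using hα.induction with
  | zero _ => exact exchangeable_schreier_zero.reorderable
  | succ γ hγ ih h => exact (exchangeable_schreier_add_one hα hγ h ih).reorderable
  | limit ξ h1 hξ ih => exact (exchangeable_schreier_limit hα h1 hξ ih).reorderable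

/-- If the intervals into which a member of `𝒮_ξ`, `ξ ≥ 1`, divides `C` contain at most three
points of `C` each, then `C` is the union of two consecutive members of `𝒮_ξ`. -/
theorem exists_two_schreier (hα : IsApproximating α) {ξ : Ordinal.{0}} (h1 : ξ < ω₁)
    (h0 : ξ ≠ 0) {C : Finset ℕ+} {π : ℕ+ → ℕ+} (hm : MonotoneOn π C) (hle : ∀ c ∈ C, π c ≤ c)
    (h3 : ∀ c ∈ C, (C.filter (π · = π c)).card ≤ 3) (hC : C.image π ∈ schreier α ξ) :
    ∃ C₁ ⊆ C, C₁ ∈ schreier α ξ ∧ C \ C₁ ∈ schreier α ξ ∧ Before C₁ (C \ C₁) := by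
  classical
  induction ξ, h1 using hα.induction generalizing C with
  | zero _ => exact absurd rfl h0
  | succ γ hγ ih h1 =>
    by_cases hγ0 : γ = 0
    · subst hγ0
      rw [zero_add] at hC ⊢
      rw [mem_schreier_one_iff] at hC
      have hcard : C.card ≤ 3 * (C.image π).card := by
        refine Finset.card_le_mul_card_image _ _ fun p hp => ?_
        obtain ⟨c, hc, rfl⟩ := Finset.mem_image.1 hp
        exact h3 c hc
      have hle' : ∀ c ∈ C, (C.image π).card ≤ (c : ℕ) := fun c hc =>
        (hC _ (Finset.mem_image_of_mem _ hc)).trans (hle c hc)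
      -- With `n` labels, `C` has at most `3n` points, all at least `n`. After the first `n` of them
      -- at most `2n` are left, and these are at least `2n`.
      obtain ⟨C₁, hC₁, hcard₁, hb⟩ := exists_initial_segment C
        (Finset.card_image_le : (C.image π).card ≤ C.card)
      refine ⟨C₁, hC₁, ?_, ?_, hb⟩
      · rw [mem_schreier_one_iff]
        intro a ha
        rw [hcard₁]
        exact hle' a (hC₁ ha)
      · rw [mem_schreier_one_iff]
        intro a ha
        rw [Finset.card_sdiff_of_subset hC₁, hcard₁]
        have hsub : C₁.image (fun x : ℕ+ => (x : ℕ)) ⊆ Finset.Ico (C.image π).card a := by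
          intro z hz
          obtain ⟨x, hx, rfl⟩ := Finset.mem_image.1 hz
          rw [Finset.mem_Ico]
          exact ⟨hle' x (hC₁ hx), hb x hx a ha⟩
        have h2 := Finset.card_le_card hsub
        rw [Finset.card_image_of_injective _ PNat.coe_injective, hcard₁, Nat.card_Ico] at h2
        have := hle' a (Finset.mem_sdiff.1 ha).1
        omega
    · rw [schreier_add_one] at hC
      obtain ⟨ρ, hρm, hρ, hρf, hρc⟩ :=
        exists_monotoneOn_of_mem_schreierSucc (empty_mem_schreier hα hγ) hC
      have hmem : ∀ c ∈ C, π c ∈ C.image π := fun c hc => Finset.mem_image_of_mem _ hc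
      have hτ : MonotoneOn (ρ ∘ π) C := fun x hx y hy hxy =>
        hρm (Finset.mem_coe.2 (hmem x hx)) (Finset.mem_coe.2 (hmem y hy)) (hm hx hy hxy)
      have hD : ∀ p, ∃ D ⊆ C.filter ((ρ ∘ π) · = p), D ∈ schreier α γ ∧
          C.filter ((ρ ∘ π) · = p) \ D ∈ schreier α γ ∧
          Before D (C.filter ((ρ ∘ π) · = p) \ D) := by
        intro p
        refine ih hγ0 (hm.mono (Finset.coe_subset.2 (Finset.filter_subset _ _)))
          (fun c hc => hle c (Finset.mem_filter.1 hc).1) ?_ ?_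
        · intro c hc
          exact (Finset.card_le_card (Finset.filter_subset_filter _ (Finset.filter_subset _ _))).trans
            (h3 c (Finset.mem_filter.1 hc).1)
        · convert hρf p using 1
          rw [Finset.filter_image]
          rfl
      choose D hDs hD1 hD2 hDb using hD
      set τ : ℕ+ → ℕ+ := ρ ∘ π
      -- The two halves of the block with label `τ c` receive the consecutive labels `2 * τ c` and
      -- `2 * τ c + 1`.
      let h : ℕ+ → ℕ+ := fun c => if c ∈ D (τ c) then 2 * τ c else 2 * τ c + 1
      have hcases : ∀ c, c ∈ D (τ c) ∧ (h c : ℕ) = 2 * τ c ∨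
          c ∉ D (τ c) ∧ (h c : ℕ) = 2 * τ c + 1 := by
        intro c
        by_cases hc : c ∈ D (τ c)
        · exact Or.inl ⟨hc, by simp [h, hc]⟩
        · exact Or.inr ⟨hc, by simp [h, hc]⟩
      have hhm : MonotoneOn h C := by
        intro x hx y hy hxy
        have h1 : (τ x : ℕ) ≤ τ y := hτ hx hy hxy
        rw [← PNat.coe_le_coe]
        rcases hcases x with ⟨hxD, hxe⟩ | ⟨hxD, hxe⟩ <;>
          rcases hcases y with ⟨hyD, hye⟩ | ⟨hyD, hye⟩
        · omega
        · omega
        · rcases h1.eq_or_lt with h1 | h1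
          · have h1 := PNat.coe_injective h1
            rw [h1] at hxD
            exact absurd (hDb (τ y) y hyD x (Finset.mem_sdiff.2
              ⟨Finset.mem_filter.2 ⟨hx, h1⟩, hxD⟩)) (not_lt.2 hxy)
          · omega
        · omega
      have hhf : ∀ p, C.filter (h · = p) ∈ schreier α γ := by
        intro p
        rcases (C.filter (h · = p)).eq_empty_or_nonempty with he | ⟨c, hc⟩
        · rw [he]; exact empty_mem_schreier hα hγ
        rw [Finset.mem_filter] at hc
        have hsame : ∀ y ∈ C.filter (h · = p), τ y = τ c ∧ (y ∈ D (τ c) ↔ c ∈ D (τ c)) := by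
          intro y hy
          rw [Finset.mem_filter] at hy
          have hyc : (h y : ℕ) = h c := by rw [hy.2, hc.2]
          have hτe : τ y = τ c := by
            apply PNat.coe_injective
            rcases hcases c with ⟨_, hxe⟩ | ⟨_, hxe⟩ <;>
              rcases hcases y with ⟨_, hye⟩ | ⟨_, hye⟩ <;> omega
          refine ⟨hτe, ?_⟩
          rcases hcases c with ⟨hxD, hxe⟩ | ⟨hxD, hxe⟩ <;>
            rcases hcases y with ⟨hyD, hye⟩ | ⟨hyD, hye⟩ <;> rw [hτe] at hyD
          · exact ⟨fun _ => hxD, fun _ => hyD⟩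
          · omega
          · omega
          · exact ⟨fun h => absurd h hyD, fun h => absurd h hxD⟩
        by_cases hcD : c ∈ D (τ c)
        · exact mem_schreier_of_subset hα hγ (hD1 (τ c)) fun y hy => (hsame y hy).2.2 hcD
        · refine mem_schreier_of_subset hα hγ (hD2 (τ c)) fun y hy => ?_
          exact Finset.mem_sdiff.2 ⟨Finset.mem_filter.2 ⟨(Finset.mem_filter.1 hy).1,
            (hsame y hy).1⟩, fun h => hcD ((hsame y hy).2.1 h)⟩
      have hcard : (C.image h).card ≤ 2 * (C.image τ).card := by
        have hsub : C.image h ⊆ (C.image τ).image (2 * ·) ∪ (C.image τ).image (2 * · + 1) := by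
          intro p hp
          obtain ⟨c, hc, rfl⟩ := Finset.mem_image.1 hp
          rw [Finset.mem_union]
          by_cases hcD : c ∈ D (τ c)
          · exact Or.inl (Finset.mem_image.2 ⟨τ c, Finset.mem_image_of_mem _ hc,
              by simp only [h, if_pos hcD]⟩)
          · exact Or.inr (Finset.mem_image.2 ⟨τ c, Finset.mem_image_of_mem _ hc,
              by simp only [h, if_neg hcD]⟩)
        have h2 := (Finset.card_le_card hsub).trans (Finset.card_union_le _ _)
        have h3 := Finset.card_image_le (s := C.image τ) (f := (2 * ·))
        have h4 := Finset.card_image_le (s := C.image τ) (f := (2 * · + 1))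
        omega
      have hn : ∀ c ∈ C, (C.image τ).card ≤ (c : ℕ) := by
        intro c hc
        rw [← Finset.image_image]
        exact (hρc _ (hmem c hc)).trans (hle c hc)
      -- There are at most twice as many half blocks as blocks, so they divide into two runs,
      -- neither longer than the number of blocks. The minimum covers the case of too few half
      -- blocks.
      obtain ⟨H₁, hH₁, hH₁c, hb⟩ := exists_initial_segment (C.image h)
        (min_le_right (C.image τ).card (C.image h).card)
      have hfil : ∀ (P : ℕ+ → Prop) [DecidablePred P] (p : ℕ+),
          (C.filter P).filter (h · = p) ∈ schreier α γ := by
        intro P _ p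
        exact mem_schreier_of_subset hα hγ (hhf p)
          (Finset.filter_subset_filter _ (Finset.filter_subset _ _))
      rw [schreier_add_one]
      refine ⟨C.filter (h · ∈ H₁), Finset.filter_subset _ _, ?_, ?_, ?_⟩
      · refine mem_schreierSucc_of_monotoneOn (ρ := h)
          (hhm.mono (Finset.coe_subset.2 (Finset.filter_subset _ _))) (hfil _) ?_
        intro a ha
        refine le_trans ?_ (hn a (Finset.mem_filter.1 ha).1)
        refine (Finset.card_le_card (t := H₁) fun q hq => ?_).trans
          (hH₁c.le.trans (min_le_left _ _))
        obtain ⟨x, hx, rfl⟩ := Finset.mem_image.1 hq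
        exact (Finset.mem_filter.1 hx).2
      · rw [← Finset.filter_not]
        refine mem_schreierSucc_of_monotoneOn (ρ := h)
          (hhm.mono (Finset.coe_subset.2 (Finset.filter_subset _ _))) (hfil _) ?_
        intro a ha
        refine le_trans ?_ (hn a (Finset.mem_filter.1 ha).1)
        refine (Finset.card_le_card (t := C.image h \ H₁) fun q hq => ?_).trans ?_
        · obtain ⟨x, hx, rfl⟩ := Finset.mem_image.1 hq
          rw [Finset.mem_filter] at hx
          exact Finset.mem_sdiff.2 ⟨Finset.mem_image_of_mem _ hx.1, hx.2⟩
        · rw [Finset.card_sdiff_of_subset hH₁, hH₁c]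
          omega
      · intro x hx y hy
        rw [← Finset.filter_not, Finset.mem_filter] at hy
        rw [Finset.mem_filter] at hx
        by_contra hxy
        have h1 := hhm (Finset.mem_coe.2 hy.1) (Finset.mem_coe.2 hx.1) (not_lt.1 hxy)
        exact absurd (hb _ hx.2 _ (Finset.mem_sdiff.2
          ⟨Finset.mem_image_of_mem _ hy.1, hy.2⟩)) (not_lt.2 h1)
  | limit ξ h1 hξ ih =>
    have hC' := hC
    rw [hα.schreier_limit h1 hξ] at hC'
    obtain ⟨n, hn, hC'⟩ := hC'
    -- The induction hypothesis excludes index 0, and `α ξ n` is a successor.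
    obtain ⟨C₁, hs, k1, k2, hb⟩ := ih n (by
      obtain ⟨β, hβ⟩ := hα.isSucc ξ h1 hξ n
      rw [hβ]
      exact (Order.succ_ne_bot β)) hm hle h3 hC'
    have hnc : ∀ c ∈ C, n ≤ c := fun c hc => (hn _ (Finset.mem_image_of_mem _ hc)).trans (hle c hc)
    rw [hα.schreier_limit h1 hξ]
    exact ⟨C₁, hs, ⟨n, fun a ha => hnc a (hs ha), k1⟩,
      ⟨n, fun a ha => hnc a (Finset.sdiff_subset ha), k2⟩, hb⟩

end

/-! ### Regular families and trees -/

/-- The properties of Schreier families that the comparison of the norms uses. -/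
structure IsRegular (ℱ : Set (Finset ℕ+)) : Prop where
  empty_mem : ∅ ∈ ℱ
  mem_of_subset : ∀ {A B : Finset ℕ+}, A ∈ ℱ → B ⊆ A → B ∈ ℱ
  mem_of_strictMonoOn : ∀ {X : Finset ℕ+} {ψ : ℕ+ → ℕ+}, StrictMonoOn ψ X →
    (∀ x ∈ X, ψ x ≤ x) → X.image ψ ∈ ℱ → X ∈ ℱ
  reorderable : Reorderable ℱ

theorem isRegular_schreier {α : Ordinal.{0} → ℕ+ → Ordinal.{0}} (hα : IsApproximating α)
    {ξ : Ordinal.{0}} (h1 : ξ < ω₁) : IsRegular (schreier α ξ) where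
  empty_mem := empty_mem_schreier hα h1
  mem_of_subset := mem_schreier_of_subset hα h1
  mem_of_strictMonoOn := mem_schreier_of_strictMonoOn hα h1
  reorderable := reorderable_schreier hα h1

/-- An injective `ψ` need not preserve the order, but reordering its one-point fibers, that is,
reordering in `𝒮_0`, makes it strictly increasing with values still in `M`; then spreading applies.
-/
theorem IsRegular.mem_of_injOn {ℱ : Set (Finset ℕ+)} (hℱ : IsRegular ℱ) {X M : Finset ℕ+}
    {ψ : ℕ+ → ℕ+} (hψ : Set.InjOn ψ X) (hle : ∀ x ∈ X, ψ x ≤ x) (hX : ∀ x ∈ X, ψ x ∈ M)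
    (hM : M ∈ ℱ) : X ∈ ℱ := by
  have h0 : Reorderable {A | A.card ≤ 1} := by
    rw [← schreier_zero fun _ _ => 0]
    exact exchangeable_schreier_zero.reorderable
  have hinj : ∀ (ρ : ℕ+ → ℕ+), Set.InjOn ρ X ↔ ∀ p, (X.filter (ρ · = p)).card ≤ 1 := by
    intro ρ
    constructor
    · intro h p
      refine Finset.card_le_one.2 fun x hx y hy => ?_
      rw [Finset.mem_filter] at hx hy
      exact h hx.1 hy.1 (hx.2.trans hy.2.symm)
    · intro h x hx y hy hxy
      exact Finset.card_le_one.1 (h (ρ y)) x (Finset.mem_filter.2 ⟨hx, hxy⟩) y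
        (Finset.mem_filter.2 ⟨hy, rfl⟩)
  obtain ⟨ρ, hm, hρ, hQ, hf⟩ := h0 X ψ hle ((hinj ψ).1 hψ)
  have hs : StrictMonoOn ρ X := fun x hx y hy hxy =>
    lt_of_le_of_ne (hm hx hy hxy.le) fun h => hxy.ne ((hinj ρ).2 hf hx hy h)
  refine hℱ.mem_of_strictMonoOn hs hρ (hℱ.mem_of_subset hM fun q hq => ?_)
  obtain ⟨x, hx, rfl⟩ := Finset.mem_image.1 hq
  obtain ⟨y, hy, hxy⟩ := Finset.mem_image.1 (hQ x hx)
  rw [← hxy]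
  exact hX y hy

/-- `Tree 𝒜 d j A`: the set `A` is the set of leaves of a tree whose root has level `j`, in which
the successors of each node form a sequence of the class `𝒜` and the leaf `a` has level `d a`. -/
inductive Tree (𝒜 : SeqClass) (d : ℕ+ → ℕ) : ℕ → Finset ℕ+ → Prop
  | leaf {j : ℕ} {a : ℕ+} (h : d a = j) : Tree 𝒜 d j {a}
  | node {j k : ℕ} (E : Fin k → Finset ℕ+) (hE : 𝒜.Mem E) (h : ∀ i, Tree 𝒜 d (j + 1) (E i)) :
      Tree 𝒜 d j (Finset.univ.biUnion E)

theorem Tree.congr {𝒜 : SeqClass} {d d' : ℕ+ → ℕ} {j : ℕ} {A : Finset ℕ+} (hA : Tree 𝒜 d j A)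
    (h : ∀ a ∈ A, d a = d' a) : Tree 𝒜 d' j A := by
  induction hA with
  | leaf ha => exact .leaf (by rw [← h _ (Finset.mem_singleton_self _), ha])
  | node E hE _ ih =>
    refine .node E hE fun i => ih i fun a ha => h a ?_
    exact Finset.mem_biUnion.2 ⟨i, Finset.mem_univ _, ha⟩

theorem Tree.le_level {𝒜 : SeqClass} {d : ℕ+ → ℕ} {j : ℕ} {A : Finset ℕ+} (hA : Tree 𝒜 d j A) :
    ∀ a ∈ A, j ≤ d a := by
  induction hA with
  | leaf ha => intro a h; rw [Finset.mem_singleton.1 h, ha]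
  | node E _ _ ih =>
    intro a ha
    obtain ⟨i, -, hi⟩ := Finset.mem_biUnion.1 ha
    exact (Nat.le_succ _).trans (ih i a hi)

/-- `h` sends each point of `A` to the least point of its class. -/
structure IsHead (h : ℕ+ → ℕ+) (A : Finset ℕ+) : Prop where
  mem : ∀ x ∈ A, h x ∈ A
  le : ∀ x ∈ A, h x ≤ x
  idem : ∀ x ∈ A, h (h x) = h x

theorem IsHead.isAllowable {ℱ : Set (Finset ℕ+)} {h : ℕ+ → ℕ+} {A : Finset ℕ+} (hh : IsHead h A)
    (hℱ : A.image h ∈ ℱ) : IsAllowable ℱ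
      (fun i => A.filter (h · = (A.image h).orderEmbOfFin rfl i)) := by
  have hmem : ∀ i, (A.image h).orderEmbOfFin rfl i ∈
      A.filter (h · = (A.image h).orderEmbOfFin rfl i) := by
    intro i
    obtain ⟨x, hx, hxe⟩ := Finset.mem_image.1 (Finset.orderEmbOfFin_mem (A.image h) rfl i)
    rw [← hxe]
    exact Finset.mem_filter.2 ⟨hh.mem x hx, hh.idem x hx⟩
  refine ⟨?_, fun i => ⟨_, hmem i⟩, ?_⟩
  · intro i j hij
    rw [Finset.disjoint_left]
    intro x hx hy
    rw [Finset.mem_filter] at hx hy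
    exact hij (((A.image h).orderEmbOfFin rfl).injective (hx.2.symm.trans hy.2))
  · convert hℱ
    have hmin : ∀ i, (A.filter (h · = (A.image h).orderEmbOfFin rfl i)).min' ⟨_, hmem i⟩ =
        (A.image h).orderEmbOfFin rfl i := by
      intro i
      refine le_antisymm (Finset.min'_le _ _ (hmem i)) (Finset.le_min' _ _ _ fun y hy => ?_)
      rw [Finset.mem_filter] at hy
      exact hy.2 ▸ hh.le y hy.1
    simp only [hmin]
    rw [← Finset.coe_inj, Finset.coe_image, Finset.coe_univ, Set.image_univ,
      Finset.range_orderEmbOfFin]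

theorem biUnion_fiber_orderEmbOfFin (h : ℕ+ → ℕ+) (A : Finset ℕ+) :
    (Finset.univ.biUnion fun i => A.filter (h · = (A.image h).orderEmbOfFin rfl i)) = A := by
  ext a
  simp only [Finset.mem_biUnion, Finset.mem_univ, true_and, Finset.mem_filter]
  constructor
  · rintro ⟨_, h, _⟩
    exact h
  · intro ha
    have h : h a ∈ Set.range ((A.image h).orderEmbOfFin rfl) := by
      rw [Finset.range_orderEmbOfFin]
      exact Finset.mem_coe.2 (Finset.mem_image_of_mem _ ha)
    obtain ⟨i, hi⟩ := h
    exact ⟨i, ha, hi.symm⟩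

theorem fiber_orderEmbOfFin {P : Finset ℕ+ → Prop} {h : ℕ+ → ℕ+} {A : Finset ℕ+}
    (hP : ∀ x ∈ A, P (A.filter (h · = h x))) (i : Fin (A.image h).card) :
    P (A.filter (h · = (A.image h).orderEmbOfFin rfl i)) := by
  obtain ⟨x, hx, hxe⟩ := Finset.mem_image.1 (Finset.orderEmbOfFin_mem (A.image h) rfl i)
  rw [← hxe]
  exact hP x hx

theorem Tree.of_isHead_allowable {ℱ : Set (Finset ℕ+)} {d : ℕ+ → ℕ} {j : ℕ} {h : ℕ+ → ℕ+}
    {A : Finset ℕ+} (hh : IsHead h A) (hℱ : A.image h ∈ ℱ)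
    (hA : ∀ x ∈ A, Tree (allowable ℱ) d (j + 1) (A.filter (h · = h x))) :
    Tree (allowable ℱ) d j A := by
  rw [← biUnion_fiber_orderEmbOfFin h A]
  exact .node _ (hh.isAllowable hℱ) (fiber_orderEmbOfFin hA)

theorem Tree.of_isHead_admissible {ℱ : Set (Finset ℕ+)} {d : ℕ+ → ℕ} {j : ℕ} {h : ℕ+ → ℕ+}
    {A : Finset ℕ+} (hh : IsHead h A) (hm : MonotoneOn h A) (hℱ : A.image h ∈ ℱ)
    (hA : ∀ x ∈ A, Tree (admissible ℱ) d (j + 1) (A.filter (h · = h x))) :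
    Tree (admissible ℱ) d j A := by
  rw [← biUnion_fiber_orderEmbOfFin h A]
  refine .node _ ⟨fun i i' hi => ?_, (hh.isAllowable hℱ).2⟩ (fiber_orderEmbOfFin hA)
  exact before_fiber hm (by simpa using hi)

/-! ### Trees compute the implicit norm -/

theorem restr_apply_of_mem {E : Finset ℕ+} {a : ℕ+} (h : a ∈ E) (x : ℕ+ →₀ ℝ) :
    restr E x a = x a := Finsupp.filter_apply_pos _ _ h

/-- Each inner node uses the implicit equation once and pays one factor `θ`. -/
theorem Tree.sum_le {𝒜 : SeqClass} {θ : ℝ} (hθ0 : 0 ≤ θ) (hθ1 : θ ≤ 1) {d : ℕ+ → ℕ} {j : ℕ}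
    {A : Finset ℕ+} (hA : Tree 𝒜 d j A) (x : ℕ+ →₀ ℝ) :
    ∑ a ∈ A, θ ^ d a * |x a| ≤ θ ^ j * implicitNorm 𝒜 θ x := by
  induction hA generalizing x with
  | leaf ha =>
    rw [Finset.sum_singleton, ha]
    exact mul_le_mul_of_nonneg_left
      ((abs_le_supNorm x _).trans (supNorm_le_implicitNorm hθ0 hθ1 x)) (pow_nonneg hθ0 _)
  | @node j k E hE _ ih =>
    rw [Finset.sum_biUnion fun i _ i' _ hi => 𝒜.disjoint hE i i' hi]
    calc ∑ i, ∑ a ∈ E i, θ ^ d a * |x a|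
        = ∑ i, ∑ a ∈ E i, θ ^ d a * |restr (E i) x a| :=
          Finset.sum_congr rfl fun i _ => Finset.sum_congr rfl fun a ha => by
            rw [restr_apply_of_mem ha]
      _ ≤ ∑ i, θ ^ (j + 1) * implicitNorm 𝒜 θ (restr (E i) x) :=
          Finset.sum_le_sum fun i _ => ih i _
      _ = θ ^ j * (θ * ∑ i, implicitNorm 𝒜 θ (restr (E i) x)) := by
          rw [← Finset.mul_sum]; ring
      _ ≤ θ ^ j * implicitNorm 𝒜 θ x := by
          refine mul_le_mul_of_nonneg_left ?_ (pow_nonneg hθ0 _)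
          rw [implicitNorm_eq hθ0 hθ1 x]
          refine le_trans (mul_le_mul_of_nonneg_left ?_ hθ0) (le_max_right _ _)
          exact le_csSup (bddAbove_sums (implicitNorm_le_l1 hθ0 hθ1) x) ⟨k, E, hE, rfl⟩

theorem exists_tree_of_lt_supNorm (𝒜 : SeqClass) {θ : ℝ} (hθ0 : 0 < θ) (x : ℕ+ →₀ ℝ) {c : ℝ}
    (j : ℕ) (hc0 : 0 ≤ c) (hc : c < supNorm x) :
    ∃ (A : Finset ℕ+) (d : ℕ+ → ℕ), Tree 𝒜 d j A ∧ A ⊆ x.support ∧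
      θ ^ j * c < ∑ a ∈ A, θ ^ d a * |x a| := by
  obtain ⟨a, ha⟩ := exists_lt_of_lt_ciSup hc
  refine ⟨{a}, fun _ => j, .leaf rfl, ?_, ?_⟩
  · rw [Finset.singleton_subset_iff, Finsupp.mem_support_iff]
    exact abs_pos.1 (hc0.trans_lt ha)
  · rw [Finset.sum_singleton]
    exact mul_lt_mul_of_pos_left ha (pow_pos hθ0 _)

/-- Suprema need not be attained, so the tree is only required to beat every `c` below the iterate.
Keeping the leaves in the support of `x` makes the subtree for `restr (E i) x` a subset of `E i`,
hence the subtrees disjoint. -/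
theorem IsRegular.exists_tree {ℱ : Set (Finset ℕ+)} (hℱ : IsRegular ℱ) {θ : ℝ} (hθ0 : 0 < θ)
    (n : ℕ) (x : ℕ+ →₀ ℝ) (c : ℝ) (j : ℕ) (hc0 : 0 ≤ c)
    (hc : c < iter (allowable ℱ) θ n x) :
    ∃ (A : Finset ℕ+) (d : ℕ+ → ℕ), Tree (allowable ℱ) d j A ∧ A ⊆ x.support ∧
      θ ^ j * c < ∑ a ∈ A, θ ^ d a * |x a| := by
  induction n generalizing x c j with
  | zero => exact exists_tree_of_lt_supNorm _ hθ0 x j hc0 hc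
  | succ n ih =>
    rcases lt_max_iff.1 hc with h | h
    · exact exists_tree_of_lt_supNorm _ hθ0 x j hc0 h
    have h' : c / θ < sSup (sums (allowable ℱ) (iter (allowable ℱ) θ n) x) := by
      rwa [div_lt_iff₀' hθ0]
    have hne : (sums (allowable ℱ) (iter (allowable ℱ) θ n) x).Nonempty := by
      rw [Set.nonempty_iff_ne_empty]
      intro he
      rw [he, Real.sSup_empty] at h'
      exact absurd h' (not_lt.2 (div_nonneg hc0 hθ0.le))
    obtain ⟨_, ⟨k, E, hE, rfl⟩, hcS⟩ := exists_lt_of_lt_csSup hne h'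
    set S := ∑ i, iter (allowable ℱ) θ n (restr (E i) x) with hS
    have hc' : 0 ≤ c / θ := div_nonneg hc0 hθ0.le
    have hS0 : 0 < S := hc'.trans_lt hcS
    -- The factor `t < 1` distributes the slack in `c / θ < S` proportionally over the successors.
    set t := c / θ / S with ht
    have ht0 : 0 ≤ t := div_nonneg hc' hS0.le
    have ht1 : t < 1 := (div_lt_one hS0).2 hcS
    have hex : ∀ i, ∃ (A : Finset ℕ+) (d : ℕ+ → ℕ),
        (A.Nonempty → Tree (allowable ℱ) d (j + 1) A) ∧ A ⊆ (restr (E i) x).support ∧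
        θ ^ (j + 1) * (t * iter (allowable ℱ) θ n (restr (E i) x)) ≤
          ∑ a ∈ A, θ ^ d a * |restr (E i) x a| ∧
        (0 < iter (allowable ℱ) θ n (restr (E i) x) →
          θ ^ (j + 1) * (t * iter (allowable ℱ) θ n (restr (E i) x)) <
          ∑ a ∈ A, θ ^ d a * |restr (E i) x a|) := by
      intro i
      rcases (iter_nonneg (𝒜 := allowable ℱ) (θ := θ) n (restr (E i) x)).eq_or_lt with h0 | h0
      -- A successor on which the iterate vanishes is dropped; since `S > 0`, some other successor
      -- keeps the inequality strict.
      · refine ⟨∅, fun _ => 0, ?_, Finset.empty_subset _, ?_, ?_⟩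
        · rintro ⟨_, h⟩
          exact absurd h (Finset.notMem_empty _)
        · rw [← h0]
          simp
        · intro h
          exact absurd h0 h.ne
      · have hlt : t * iter (allowable ℱ) θ n (restr (E i) x) <
            iter (allowable ℱ) θ n (restr (E i) x) := mul_lt_of_lt_one_left h0 ht1
        obtain ⟨A, d, hA, hAs, hsum⟩ := ih (restr (E i) x) _ (j + 1) (mul_nonneg ht0 h0.le) hlt
        exact ⟨A, d, fun _ => hA, hAs, hsum.le, fun _ => hsum⟩
    choose A d hA hAs hle hlt using hex
    have hAE : ∀ i, A i ⊆ E i := by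
      intro i a ha
      have h := hAs i ha
      unfold restr at h
      rw [Finsupp.support_filter] at h
      exact (Finset.mem_filter.1 h).2
    have hAx : ∀ i, A i ⊆ x.support := by
      intro i a ha
      have h := hAs i ha
      unfold restr at h
      rw [Finsupp.support_filter] at h
      exact (Finset.mem_filter.1 h).1
    have hEd := (allowable ℱ).disjoint hE
    have hAd : ∀ i i', i ≠ i' → Disjoint (A i) (A i') := fun i i' hi =>
      (hEd i i' hi).mono (hAE i) (hAE i')
    have huniq : ∀ i i' a, a ∈ E i → a ∈ E i' → i = i' := by
      intro i i' a h1 h2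
      by_contra hne
      exact Finset.disjoint_left.1 (hEd i i' hne) h1 h2
    obtain ⟨σ, hσ⟩ := exists_head A hAd
    obtain ⟨μ, hμ⟩ := exists_head E hEd
    classical
    let D : ℕ+ → ℕ := fun a => if h : ∃ i, a ∈ A i then d h.choose a else 0
    have hD : ∀ i, ∀ a ∈ A i, D a = d i a := by
      intro i a ha
      have h : ∃ i, a ∈ A i := ⟨i, ha⟩
      have hi : h.choose = i := huniq _ _ a (hAE _ h.choose_spec) (hAE _ ha)
      simp only [D, dif_pos h, hi]
    have hmemU : ∀ a, a ∈ Finset.univ.biUnion A ↔ ∃ i, a ∈ A i := by simp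
    refine ⟨Finset.univ.biUnion A, D, ?_, ?_, ?_⟩
    · refine Tree.of_isHead_allowable (h := σ) ⟨?_, ?_, ?_⟩ ?_ ?_
      · intro a ha
        obtain ⟨i, hi⟩ := (hmemU a).1 ha
        exact (hmemU _).2 ⟨i, (hσ i a hi).1⟩
      · intro a ha
        obtain ⟨i, hi⟩ := (hmemU a).1 ha
        exact (hσ i a hi).2 a hi
      · intro a ha
        obtain ⟨i, hi⟩ := (hmemU a).1 ha
        have h1 := hσ i a hi
        have h2 := hσ i _ h1.1
        exact le_antisymm (h2.2 _ h1.1) (h1.2 _ h2.1)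
      · obtain ⟨hEne, hEM⟩ := hE.2
        have hheads : ∀ q ∈ (Finset.univ.biUnion A).image σ, ∃ i, q ∈ A i ∧ ∀ y ∈ A i, q ≤ y := by
          intro q hq
          obtain ⟨a, ha, rfl⟩ := Finset.mem_image.1 hq
          obtain ⟨i, hi⟩ := (hmemU a).1 ha
          exact ⟨i, hσ i a hi⟩
        -- The leaf sets `A i` may start later than `E i` or be empty, so their minima dominate
        -- distinct minima of the original sequence.
        refine hℱ.mem_of_injOn (ψ := μ) ?_ ?_ ?_ hEM
        · intro q hq r hr hqr
          obtain ⟨i, hi, hqi⟩ := hheads q hq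
          obtain ⟨i', hi', hri⟩ := hheads r hr
          have h1 := (hμ i q (hAE i hi)).1
          rw [hqr] at h1
          obtain rfl := huniq _ _ _ h1 (hμ i' r (hAE i' hi')).1
          exact le_antisymm (hqi r hi') (hri q hi)
        · intro q hq
          obtain ⟨i, hi, hqi⟩ := hheads q hq
          exact (hμ i q (hAE i hi)).2 q (hAE i hi)
        · intro q hq
          obtain ⟨i, hi, hqi⟩ := hheads q hq
          refine Finset.mem_image.2 ⟨i, Finset.mem_univ _, ?_⟩
          exact le_antisymm (Finset.min'_le _ _ (hμ i q (hAE i hi)).1)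
            ((hμ i q (hAE i hi)).2 _ (Finset.min'_mem _ _))
      · intro a ha
        obtain ⟨i, hi⟩ := (hmemU a).1 ha
        have hfib : (Finset.univ.biUnion A).filter (σ · = σ a) = A i := by
          ext b
          rw [Finset.mem_filter, hmemU]
          constructor
          · rintro ⟨⟨i', hi'⟩, hb⟩
            have h1 := (hσ i' b hi').1
            rw [hb] at h1
            obtain rfl := huniq _ _ _ (hAE _ h1) (hAE _ (hσ i a hi).1)
            exact hi'
          · intro hb
            exact ⟨⟨i, hb⟩, le_antisymm ((hσ i b hb).2 _ (hσ i a hi).1)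
              ((hσ i a hi).2 _ (hσ i b hb).1)⟩
        rw [hfib]
        exact (hA i ⟨a, hi⟩).congr fun b hb => (hD i b hb).symm
    · intro a ha
      obtain ⟨i, hi⟩ := (hmemU a).1 ha
      exact hAx i hi
    · have hsum : ∑ a ∈ Finset.univ.biUnion A, θ ^ D a * |x a| =
          ∑ i, ∑ a ∈ A i, θ ^ d i a * |restr (E i) x a| := by
        rw [Finset.sum_biUnion fun i _ i' _ hi => hAd i i' hi]
        refine Finset.sum_congr rfl fun i _ => Finset.sum_congr rfl fun a ha => ?_
        rw [hD i a ha, restr_apply_of_mem (hAE i ha)]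
      have hleft : θ ^ j * c =
          ∑ i, θ ^ (j + 1) * (t * iter (allowable ℱ) θ n (restr (E i) x)) := by
        rw [← Finset.mul_sum, ← Finset.mul_sum, ← hS, ht, div_mul_cancel₀ _ hS0.ne', pow_succ,
          mul_assoc, mul_div_cancel₀ _ hθ0.ne']
      rw [hsum, hleft]
      refine Finset.sum_lt_sum (fun i _ => hle i) ?_
      obtain ⟨i, hi, hpos⟩ := Finset.exists_lt_of_sum_lt
        (s := Finset.univ) (f := fun _ => (0 : ℝ)) (by simpa using hS0)
      exact ⟨i, hi, hlt i hpos⟩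

/-! ### From allowable trees to consecutive pairs -/

/-- `PairNode ℱ d j A`: the set `A` is empty or the set of leaves of a tree as in `Tree` whose root
is an inner node of level `j`, in which the successors of each node come in consecutive pairs, each
of them consisting of at most one inner node followed by at most one leaf. The pairs are the fibers
of `ρ`, and their minima dominate distinct elements of a member of `ℱ`. -/
inductive PairNode (ℱ : Set (Finset ℕ+)) (d : ℕ+ → ℕ) : ℕ → Finset ℕ+ → Prop
  | mk {j : ℕ} {A M : Finset ℕ+} (ρ : ℕ+ → ℕ+) (hm : MonotoneOn ρ A) (hle : ∀ x ∈ A, ρ x ≤ x)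
      (hM : M ∈ ℱ) (hρ : ∀ x ∈ A, ρ x ∈ M)
      (hleaf : ∀ x ∈ A, d x = j + 1 → ∀ y ∈ A, ρ y = ρ x → y ≤ x)
      (hnode : ∀ x ∈ A, PairNode ℱ d (j + 1)
        ((A.filter (ρ · = ρ x)).filter (d · ≠ j + 1))) : PairNode ℱ d j A

/-- An inner node of level `j`, followed by at most one leaf of level `j`. -/
def PairSet (ℱ : Set (Finset ℕ+)) (d : ℕ+ → ℕ) (j : ℕ) (U : Finset ℕ+) : Prop :=
  (∀ x ∈ U, d x = j → ∀ y ∈ U, y ≤ x) ∧ PairNode ℱ d j (U.filter (d · ≠ j))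

theorem PairNode.of_pairSet {ℱ : Set (Finset ℕ+)} {d : ℕ+ → ℕ} {j : ℕ} {A M : Finset ℕ+}
    (ρ : ℕ+ → ℕ+) (hm : MonotoneOn ρ A) (hle : ∀ x ∈ A, ρ x ≤ x) (hM : M ∈ ℱ)
    (hρ : ∀ x ∈ A, ρ x ∈ M) (h : ∀ x ∈ A, PairSet ℱ d (j + 1) (A.filter (ρ · = ρ x))) :
    PairNode ℱ d j A :=
  .mk ρ hm hle hM hρ
    (fun x hx hd y hy hxy => (h x hx).1 x (Finset.mem_filter.2 ⟨hx, rfl⟩) hd y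
      (Finset.mem_filter.2 ⟨hy, hxy⟩))
    fun x hx => (h x hx).2

/-- Labels dominated by the points survive the passage to a subset, where actual minima would
change. -/
theorem PairNode.mono {ℱ : Set (Finset ℕ+)} {d : ℕ+ → ℕ} {j : ℕ} {A B : Finset ℕ+}
    (hA : PairNode ℱ d j A) (hB : B ⊆ A) : PairNode ℱ d j B := by
  induction hA generalizing B with
  | mk ρ hm hle hM hρ hleaf _ ih =>
    refine .mk ρ (hm.mono (Finset.coe_subset.2 hB)) (fun x hx => hle x (hB hx)) hM
      (fun x hx => hρ x (hB hx)) (fun x hx hd y hy => hleaf x (hB hx) hd y (hB hy)) fun x hx => ?_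
    exact ih x (hB hx) (Finset.filter_subset_filter _ (Finset.filter_subset_filter _ hB))

theorem PairSet.mono {ℱ : Set (Finset ℕ+)} {d : ℕ+ → ℕ} {j : ℕ} {U V : Finset ℕ+}
    (hU : PairSet ℱ d j U) (hV : V ⊆ U) : PairSet ℱ d j V :=
  ⟨fun x hx hd y hy => hU.1 x (hV hx) hd y (hV hy), hU.2.mono (Finset.filter_subset_filter _ hV)⟩

/-- An allowable tree is a leaf, or it divides into allowable trees of the next level. -/
theorem Tree.leaf_or_node {ℱ : Set (Finset ℕ+)} {d : ℕ+ → ℕ} {j : ℕ} {B : Finset ℕ+}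
    (hB : Tree (allowable ℱ) d j B) : (∃ a, d a = j ∧ B = {a}) ∨
      (∀ a ∈ B, j + 1 ≤ d a) ∧ ∃ σ : ℕ+ → ℕ+, ∃ M ∈ ℱ, ∀ x ∈ B, σ x ∈ B ∧ σ x ≤ x ∧ σ x ∈ M ∧
        Tree (allowable ℱ) d (j + 1) (B.filter (σ · = σ x)) := by
  cases hB with
  | leaf h => exact Or.inl ⟨_, h, rfl⟩
  | node E hE h =>
    right
    have hd := (allowable ℱ).disjoint hE
    obtain ⟨σ, hσ⟩ := exists_head E hd
    obtain ⟨hne, hM⟩ := hE.2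
    constructor
    · intro a ha
      obtain ⟨i, -, hi⟩ := Finset.mem_biUnion.1 ha
      exact (h i).le_level a hi
    refine ⟨σ, _, hM, fun x hx => ?_⟩
    obtain ⟨i, -, hi⟩ := Finset.mem_biUnion.1 hx
    have h1 := hσ i x hi
    refine ⟨Finset.mem_biUnion.2 ⟨i, Finset.mem_univ _, h1.1⟩, h1.2 x hi,
      Finset.mem_image.2 ⟨i, Finset.mem_univ _,
        le_antisymm (Finset.min'_le _ _ h1.1) (h1.2 _ (Finset.min'_mem _ _))⟩, ?_⟩
    convert h i using 1
    ext y
    simp only [Finset.mem_filter, Finset.mem_biUnion, Finset.mem_univ, true_and]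
    constructor
    · rintro ⟨⟨i', hi'⟩, hy⟩
      have h2 := (hσ i' y hi').1
      rw [hy] at h2
      have : i' = i := by
        by_contra hne
        exact Finset.disjoint_left.1 (hd _ _ hne) h2 h1.1
      rwa [← this]
    · intro hy
      exact ⟨⟨i, hy⟩, le_antisymm ((hσ i y hy).2 _ h1.1) (h1.2 _ (hσ i y hy).1)⟩

/-- A monotone function `κ` into `ℕ` can be replaced by one into a set `P` of labels that satisfies
`ρ x ≤ x`, if there are enough labels. -/
theorem exists_label {A P : Finset ℕ+} {κ : ℕ+ → ℕ} (hκ : MonotoneOn κ A)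
    (hP : ∀ x ∈ A, κ x < (P.filter (· ≤ x)).card) :
    ∃ ρ : ℕ+ → ℕ+, MonotoneOn ρ A ∧ (∀ x ∈ A, ρ x ≤ x) ∧ (∀ x ∈ A, ρ x ∈ P) ∧
      ∀ x ∈ A, ∀ y ∈ A, ρ x = ρ y → κ x = κ y := by
  have hlt : ∀ x ∈ A, κ x < P.card := fun x hx =>
    (hP x hx).trans_le (Finset.card_le_card (Finset.filter_subset _ _))
  let e := P.orderEmbOfFin rfl
  let ρ : ℕ+ → ℕ+ := fun x => if h : κ x < P.card then e ⟨κ x, h⟩ else 1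
  have hρ : ∀ x (hx : x ∈ A), ρ x = e ⟨κ x, hlt x hx⟩ := fun x hx => dif_pos (hlt x hx)
  refine ⟨ρ, ?_, ?_, ?_, ?_⟩
  · intro x hx y hy hxy
    rw [hρ x hx, hρ y hy]
    exact e.monotone (Fin.mk_le_mk.2 (hκ hx hy hxy))
  · intro x hx
    rw [hρ x hx]
    by_contra hlt'
    rw [not_le] at hlt'
    have hsub : P.filter (· ≤ x) ⊆ (Finset.Iio (⟨κ x, hlt x hx⟩ : Fin P.card)).image e := by
      intro p hp
      rw [Finset.mem_filter] at hp
      have h : p ∈ Set.range e := by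
        rw [Finset.range_orderEmbOfFin]
        exact hp.1
      obtain ⟨i, rfl⟩ := h
      exact Finset.mem_image_of_mem _ (Finset.mem_Iio.2
        (e.lt_iff_lt.1 (hp.2.trans_lt hlt')))
    have := (Finset.card_le_card hsub).trans Finset.card_image_le
    rw [Fin.card_Iio] at this
    exact absurd (hP x hx) (not_lt.2 this)
  · intro x hx
    rw [hρ x hx]
    exact Finset.orderEmbOfFin_mem _ _ _
  · intro x hx y hy hxy
    rw [hρ x hx, hρ y hy] at hxy
    exact Fin.mk.inj_iff.1 (e.injective hxy)

/-- The rearrangement step, for several interlaced trees of one level `j` at once. By induction the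
successors of all inner nodes are made consecutive together; `reorderable`, applied to their labels,
groups them into consecutive inner nodes again; finally the leaves of level `j` are inserted where
they stand. The number `n` bounds the remaining height. -/
theorem IsRegular.exists_pairSet {ℱ : Set (Finset ℕ+)} (hℱ : IsRegular ℱ) {d : ℕ+ → ℕ} (n j : ℕ)
    {A : Finset ℕ+} {π : ℕ+ → ℕ+} (hd : ∀ a ∈ A, d a < j + n) (hπ : ∀ x ∈ A, π x ≤ x)
    (hA : ∀ x ∈ A, Tree (allowable ℱ) d j (A.filter (π · = π x))) :
    ∃ ρ : ℕ+ → ℕ+, MonotoneOn ρ A ∧ (∀ x ∈ A, ρ x ≤ x) ∧ (∀ x ∈ A, ρ x ∈ A.image π) ∧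
      ∀ x ∈ A, PairSet ℱ d j (A.filter (ρ · = ρ x)) := by
  induction n generalizing j A π with
  | zero =>
    have hA' : ∀ x, x ∉ A := fun x hx =>
      absurd ((hA x hx).le_level x (Finset.mem_filter.2 ⟨hx, rfl⟩)) (not_le.2 (hd x hx))
    exact ⟨id, monotoneOn_id, fun x hx => absurd hx (hA' x), fun x hx => absurd hx (hA' x),
      fun x hx => absurd hx (hA' x)⟩
  | succ n ih =>
    have hleaf : ∀ y ∈ A, d y = j → ∀ x ∈ A, π x = π y → x = y := by
      intro y hy hdy x hx hxy
      have hym : y ∈ A.filter (π · = π y) := Finset.mem_filter.2 ⟨hy, rfl⟩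
      have hxm : x ∈ A.filter (π · = π y) := Finset.mem_filter.2 ⟨hx, hxy⟩
      rcases (hA y hy).leaf_or_node with ⟨a, -, ha⟩ | ⟨h, -⟩
      · rw [ha, Finset.mem_singleton] at hxm hym
        rw [hxm, hym]
      · have := h y hym
        omega
    set I := A.filter (d · ≠ j) with hI
    have hIA : I ⊆ A := Finset.filter_subset _ _
    -- For the tree labelled `p`, the function `σ` sends a point to the minimum of its successor
    -- set, and `M` is the member of `ℱ` formed by these minima.
    have hS : ∀ p, ∃ (σ : ℕ+ → ℕ+) (M : Finset ℕ+), M ∈ ℱ ∧ ∀ x ∈ I, π x = p →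
        σ x ∈ I ∧ π (σ x) = p ∧ σ x ≤ x ∧ σ x ∈ M ∧
        Tree (allowable ℱ) d (j + 1) (I.filter fun y => π y = p ∧ σ y = σ x) := by
      intro p
      by_cases hp : ∃ x ∈ I, π x = p
      · obtain ⟨x₀, hx₀, rfl⟩ := hp
        rcases (hA x₀ (hIA hx₀)).leaf_or_node with ⟨a, hda, ha⟩ | ⟨h, σ, M, hM, hσ⟩
        · have h1 : x₀ ∈ A.filter (π · = π x₀) := Finset.mem_filter.2 ⟨hIA hx₀, rfl⟩
          rw [ha, Finset.mem_singleton] at h1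
          exact absurd (h1 ▸ hda) (Finset.mem_filter.1 hx₀).2
        · have hfib : A.filter (π · = π x₀) = I.filter (π · = π x₀) := by
            ext y
            simp only [hI, Finset.mem_filter]
            refine ⟨fun hy => ⟨⟨hy.1, fun hdy => ?_⟩, hy.2⟩, fun hy => ⟨hy.1.1, hy.2⟩⟩
            have := h y (Finset.mem_filter.2 hy)
            omega
          rw [hfib] at hσ
          refine ⟨σ, M, hM, fun x hx hxp => ?_⟩
          obtain ⟨h1, h2, h3, h4⟩ := hσ x (Finset.mem_filter.2 ⟨hx, hxp⟩)
          rw [Finset.mem_filter] at h1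
          rw [Finset.filter_filter] at h4
          exact ⟨h1.1, h1.2, h2, h3, h4⟩
      · exact ⟨id, ∅, hℱ.empty_mem, fun x hx hxp => absurd ⟨x, hx, hxp⟩ hp⟩
    choose S M hM hS using hS
    set σ : ℕ+ → ℕ+ := fun x => S (π x) x with hσ
    have hσI : ∀ x ∈ I, σ x ∈ I := fun x hx => (hS _ x hx rfl).1
    have hπσ : ∀ x ∈ I, π (σ x) = π x := fun x hx => (hS _ x hx rfl).2.1
    obtain ⟨ρ₁, hm₁, hle₁, hQ₁, hf₁⟩ := ih (j + 1) (A := I) (π := σ)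
      (fun a ha => by have := hd a (hIA ha); omega)
      (fun x hx => (hS _ x hx rfl).2.2.1) (by
        intro x hx
        convert (hS _ x hx rfl).2.2.2.2 using 1
        refine Finset.filter_congr fun y hy => ?_
        constructor
        · intro h
          have hyx : π y = π x := by rw [← hπσ y hy, ← hπσ x hx, h]
          refine ⟨hyx, ?_⟩
          rw [← hyx]
          simpa only [hσ, hyx] using h
        · rintro ⟨h1, h2⟩
          simpa only [hσ, h1] using h2)
    -- The minima of all successors are partitioned by `π` into members of `ℱ`, one for each inner
    -- node; this partition is made consecutive.
    obtain ⟨ρ₂, hm₂, hle₂, hQ₂, hf₂⟩ := hℱ.reorderable (I.image σ) π (by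
        intro q hq
        obtain ⟨x, hx, rfl⟩ := Finset.mem_image.1 hq
        exact hπ _ (hIA (hσI x hx))) (by
        intro p
        refine hℱ.mem_of_subset (hM p) fun q hq => ?_
        rw [Finset.mem_filter] at hq
        obtain ⟨⟨x, hx, rfl⟩, hxp⟩ := And.intro (Finset.mem_image.1 hq.1) hq.2
        rw [hπσ x hx] at hxp
        subst hxp
        exact (hS _ x hx rfl).2.2.2.1)
    set τ : ℕ+ → ℕ+ := ρ₂ ∘ ρ₁ with hτ
    have hτm : MonotoneOn τ I := fun x hx y hy hxy =>
      hm₂ (Finset.mem_coe.2 (hQ₁ x hx)) (Finset.mem_coe.2 (hQ₁ y hy)) (hm₁ hx hy hxy)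
    have hτle : ∀ x ∈ I, τ x ≤ x := fun x hx => (hle₂ _ (hQ₁ x hx)).trans (hle₁ x hx)
    have hτP : ∀ x ∈ I, τ x ∈ I.image π := by
      intro x hx
      obtain ⟨q, hq, hqx⟩ := Finset.mem_image.1 (hQ₂ _ (hQ₁ x hx))
      obtain ⟨y, hy, rfl⟩ := Finset.mem_image.1 hq
      exact Finset.mem_image.2 ⟨_, hσI y hy, hqx⟩
    -- `t x` counts the new inner nodes begun up to `x`, and `s x` the leaves of level `j` strictly
    -- before `x`. The strict inequality makes a leaf the last point of its pair.
    set t : ℕ+ → ℕ := fun x => ((I.filter (· ≤ x)).image τ).card with ht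
    set s : ℕ+ → ℕ := fun x => (A.filter fun y => d y = j ∧ y < x).card with hs
    have htm : Monotone t := fun x y hxy => Finset.card_le_card (Finset.image_subset_image
      (Finset.monotone_filter_right _ fun z _ hz => le_trans hz hxy))
    have hsm : Monotone s := fun x y hxy => Finset.card_le_card
      (Finset.monotone_filter_right _ fun z _ hz => ⟨hz.1, lt_of_lt_of_le hz.2 hxy⟩)
    have hslt : ∀ x ∈ A, d x = j → ∀ y, x < y → s x < s y := by
      intro x hx hdx y hxy
      refine Finset.card_lt_card (Finset.ssubset_iff_of_subset ?_ |>.2 ⟨x, ?_, ?_⟩)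
      · exact Finset.monotone_filter_right _ fun z _ hz => ⟨hz.1, hz.2.trans hxy⟩
      · exact Finset.mem_filter.2 ⟨hx, hdx, hxy⟩
      · intro h
        exact lt_irrefl _ (Finset.mem_filter.1 h).2.2
    have htpos : ∀ x ∈ I, 0 < t x := fun x hx => Finset.card_pos.2
      ⟨τ x, Finset.mem_image_of_mem _ (Finset.mem_filter.2 ⟨hx, le_rfl⟩)⟩
    have hinj : ∀ B ⊆ A.filter (d · = j), (B.image π).card = B.card := by
      intro B hB
      refine Finset.card_image_of_injOn fun x hx y hy hxy => ?_
      have hx' := Finset.mem_filter.1 (hB hx)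
      have hy' := Finset.mem_filter.1 (hB hy)
      exact hleaf y hy'.1 hy'.2 x hx'.1 hxy
    -- A rise of `s`, or of `t` from a positive value, starts a new pair. Truncated subtraction
    -- makes the numbering start at 0 even if leaves precede all inner nodes. Enough labels exist:
    -- up to `x` there are the `t x` labels of inner nodes and the `s x` labels of earlier leaves,
    -- and these are distinct.
    obtain ⟨ρ, hm, hle, hQ, hf⟩ := exists_label (A := A) (P := A.image π)
      (κ := fun x => (t x - 1) + s x)
      (fun x _ y _ hxy => add_le_add (Nat.sub_le_sub_right (htm hxy) 1) (hsm hxy)) (by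
        intro x hx
        have hsubP : ∀ B ⊆ A.filter (d · = j), (∀ b ∈ B, b ≤ x) →
            B.image π ⊆ (A.image π).filter (· ≤ x) := by
          intro B hB hBx p hp
          obtain ⟨b, hb, rfl⟩ := Finset.mem_image.1 hp
          have hbA := (Finset.mem_filter.1 (hB hb)).1
          exact Finset.mem_filter.2 ⟨Finset.mem_image_of_mem _ hbA, (hπ b hbA).trans (hBx b hb)⟩
        have hL : (A.filter fun y => d y = j ∧ y < x) ⊆ A.filter (d · = j) :=
          Finset.monotone_filter_right _ fun z _ hz => hz.1
        rcases (t x).eq_zero_or_pos with h0 | h0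
        -- If no inner node has begun, `x` is itself a leaf and supplies the additional label.
        · have hxI : x ∉ I := fun h => (htpos x h).ne' h0
          have hdx : d x = j := by
            by_contra h
            exact hxI (Finset.mem_filter.2 ⟨hx, h⟩)
          have hins : insert x (A.filter fun y => d y = j ∧ y < x) ⊆ A.filter (d · = j) :=
            Finset.insert_subset (Finset.mem_filter.2 ⟨hx, hdx⟩) hL
          have h2 := Finset.card_le_card (hsubP _ hins (by
            intro b hb
            rcases Finset.mem_insert.1 hb with rfl | hb
            · exact le_rfl
            · exact (Finset.mem_filter.1 hb).2.2.le))
          rw [hinj _ hins, Finset.card_insert_of_notMem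
            fun h => lt_irrefl _ (Finset.mem_filter.1 h).2.2] at h2
          change (t x - 1) + s x < _
          rw [h0]
          change 0 - 1 + (A.filter fun y => d y = j ∧ y < x).card < _
          omega
        · have hdis : Disjoint ((I.filter (· ≤ x)).image τ)
              ((A.filter fun y => d y = j ∧ y < x).image π) := by
            rw [Finset.disjoint_left]
            intro p hp hp'
            obtain ⟨y, hy, rfl⟩ := Finset.mem_image.1 hp
            obtain ⟨z, hz, hzy⟩ := Finset.mem_image.1 hp'
            obtain ⟨w, hw, hwy⟩ := Finset.mem_image.1 (hτP y (Finset.mem_filter.1 hy).1)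
            have hz := Finset.mem_filter.1 hz
            obtain rfl := hleaf z hz.1 hz.2.1 w (hIA hw) (hwy.trans hzy.symm)
            exact (Finset.mem_filter.1 hw).2 hz.2.1
          have hsub : (I.filter (· ≤ x)).image τ ∪ (A.filter fun y => d y = j ∧ y < x).image π ⊆
              (A.image π).filter (· ≤ x) := by
            refine Finset.union_subset ?_ (hsubP _ hL fun b hb => (Finset.mem_filter.1 hb).2.2.le)
            intro p hp
            obtain ⟨y, hy, rfl⟩ := Finset.mem_image.1 hp
            rw [Finset.mem_filter] at hy
            exact Finset.mem_filter.2 ⟨Finset.image_subset_image hIA (hτP y hy.1),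
              (hτle y hy.1).trans hy.2⟩
          have h2 := Finset.card_le_card hsub
          rw [Finset.card_union_of_disjoint hdis, hinj _ hL] at h2
          change (t x - 1) + s x < _
          change t x + s x ≤ _ at h2
          omega)
    refine ⟨ρ, hm, hle, hQ, fun x hx => ?_⟩
    -- Two monotone counts whose sum is constant are both constant.
    have hts : ∀ y ∈ A.filter (ρ · = ρ x), ∀ z ∈ A.filter (ρ · = ρ x), y ≤ z →
        t y - 1 = t z - 1 ∧ s y = s z := by
      intro y hy z hz hyz
      rw [Finset.mem_filter] at hy hz
      have h1 : (t y - 1) + s y = (t z - 1) + s z :=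
        hf y hy.1 z hz.1 (hy.2.trans hz.2.symm)
      have h2 := htm hyz
      have h3 := hsm hyz
      omega
    refine ⟨?_, ?_⟩
    · intro y hy hdy z hz
      by_contra hyz
      rw [not_le] at hyz
      exact (hslt y (Finset.mem_filter.1 hy).1 hdy z hyz).ne (hts y hy z hz hyz.le).2
    · set G := (A.filter (ρ · = ρ x)).filter (d · ≠ j) with hG
      have hGI : G ⊆ I := Finset.filter_subset_filter _ (Finset.filter_subset _ _)
      have hGA : G ⊆ A.filter (ρ · = ρ x) := Finset.filter_subset _ _
      -- As `t` agrees at `y` and `z`, the label `τ z` has already occurred at some `w ≤ y`, and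
      -- monotonicity forces `τ y = τ z`. So the inner points of a pair lie in one node.
      have hτG' : ∀ y ∈ G, ∀ z ∈ G, y ≤ z → τ y = τ z := by
        intro y hy z hz hyz
        have h1 := (hts y (hGA hy) z (hGA hz) hyz).1
        have h2 := htpos y (hGI hy)
        have h3 := htpos z (hGI hz)
        have hsub : (I.filter (· ≤ y)).image τ ⊆ (I.filter (· ≤ z)).image τ :=
          Finset.image_subset_image
            (Finset.monotone_filter_right _ fun w _ hw => le_trans hw hyz)
        have heq := Finset.eq_of_subset_of_card_le hsub (by
          change t z ≤ t y
          omega)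
        have hmem : τ z ∈ (I.filter (· ≤ y)).image τ := by
          rw [heq]
          exact Finset.mem_image_of_mem _ (Finset.mem_filter.2 ⟨hGI hz, le_rfl⟩)
        obtain ⟨w, hw, hwz⟩ := Finset.mem_image.1 hmem
        rw [Finset.mem_filter] at hw
        exact le_antisymm (hτm (hGI hy) (hGI hz) hyz) (hwz ▸ hτm hw.1 (hGI hy) hw.2)
      have hτG : ∀ y ∈ G, ∀ z ∈ G, τ y = τ z := by
        intro y hy z hz
        rcases le_total y z with h | h
        · exact hτG' y hy z hz h
        · exact (hτG' z hz y hy h).symm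
      have hpair : ∀ y ∈ G, PairSet ℱ d (j + 1) (G.filter (ρ₁ · = ρ₁ y)) := fun y hy =>
        (hf₁ y (hGI hy)).mono (Finset.filter_subset_filter _ hGI)
      have hGm : MonotoneOn ρ₁ G := hm₁.mono (Finset.coe_subset.2 hGI)
      rcases G.eq_empty_or_nonempty with he | ⟨g, hg⟩
      · exact .of_pairSet ρ₁ hGm (fun y hy => hle₁ y (hGI hy)) hℱ.empty_mem
          (fun y hy => by rw [he] at hy; exact absurd hy (Finset.notMem_empty _)) hpair
      · exact .of_pairSet ρ₁ hGm (fun y hy => hle₁ y (hGI hy)) (hf₂ (τ g))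
          (fun y hy => Finset.mem_filter.2 ⟨hQ₁ y (hGI hy), hτG y hy g hg⟩) hpair

/-! ### Sets divided into few consecutive trees -/

/-- `U` is divided into at most `r` consecutive sets with the property `T`. -/
def Pieces (T : Finset ℕ+ → Prop) (r : ℕ) (U : Finset ℕ+) : Prop :=
  ∃ h : ℕ+ → ℕ+, IsHead h U ∧ MonotoneOn h U ∧ (∀ x ∈ U, T (U.filter (h · = h x))) ∧
    (U.image h).card ≤ r

theorem Pieces.of_nonempty {T : Finset ℕ+ → Prop} {U : Finset ℕ+} (hU : U.Nonempty → T U) :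
    Pieces T 1 U := by
  rcases U.eq_empty_or_nonempty with rfl | hne
  · exact ⟨id, ⟨by simp, by simp, by simp⟩, monotoneOn_id, by simp, by simp⟩
  · refine ⟨fun _ => U.min' hne, ⟨fun _ _ => U.min'_mem hne, fun x hx => U.min'_le x hx,
      fun _ _ => rfl⟩, monotoneOn_const, fun x _ => ?_, ?_⟩
    · simpa using hU hne
    · rw [Finset.image_const hne, Finset.card_singleton]

/-- Dividing each fiber of `ρ` separately divides all of `A`, because the fibers themselves are
consecutive. -/
theorem Pieces.glue {T : Finset ℕ+ → Prop} {r : ℕ} {A : Finset ℕ+} {ρ : ℕ+ → ℕ+}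
    (hρ : MonotoneOn ρ A) (hA : ∀ x ∈ A, Pieces T r (A.filter (ρ · = ρ x))) :
    ∃ h : ℕ+ → ℕ+, IsHead h A ∧ MonotoneOn h A ∧ (∀ x ∈ A, T (A.filter (h · = h x))) ∧
      (∀ x ∈ A, ρ (h x) = ρ x) ∧ ∀ x ∈ A, ((A.filter (ρ · = ρ x)).image h).card ≤ r := by
  have hex : ∀ p, ∃ h : ℕ+ → ℕ+, ∀ x ∈ A, ρ x = p → IsHead h (A.filter (ρ · = p)) ∧
      MonotoneOn h (A.filter (ρ · = p)) ∧
      (∀ x ∈ A.filter (ρ · = p), T ((A.filter (ρ · = p)).filter (h · = h x))) ∧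
      ((A.filter (ρ · = p)).image h).card ≤ r := by
    intro p
    by_cases hp : ∃ x ∈ A, ρ x = p
    · obtain ⟨x, hx, rfl⟩ := hp
      obtain ⟨h, hh⟩ := hA x hx
      exact ⟨h, fun _ _ _ => hh⟩
    · exact ⟨id, fun x hx hxp => absurd ⟨x, hx, hxp⟩ hp⟩
  choose H hH using hex
  have hself : ∀ x ∈ A, x ∈ A.filter (ρ · = ρ x) := fun x hx => Finset.mem_filter.2 ⟨hx, rfl⟩
  have hmem : ∀ x ∈ A, H (ρ x) x ∈ A ∧ ρ (H (ρ x) x) = ρ x := fun x hx =>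
    Finset.mem_filter.1 ((hH _ x hx rfl).1.mem x (hself x hx))
  refine ⟨fun x => H (ρ x) x, ⟨fun x hx => (hmem x hx).1,
    fun x hx => (hH _ x hx rfl).1.le x (hself x hx), fun x hx => ?_⟩, ?_, fun x hx => ?_,
    fun x hx => (hmem x hx).2, fun x hx => ?_⟩
  · simp only [(hmem x hx).2]
    exact (hH _ x hx rfl).1.idem x (hself x hx)
  · intro x hx y hy hxy
    rcases (hρ hx hy hxy).eq_or_lt with h | h
    · simp only [h]
      exact (hH _ y hy rfl).2.1 (Finset.mem_coe.2 (Finset.mem_filter.2 ⟨hx, h⟩))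
        (Finset.mem_coe.2 (hself y hy)) hxy
    · exact (before_fiber hρ h _ (Finset.mem_filter.2 (hmem x hx)) _
        (Finset.mem_filter.2 (hmem y hy))).le
  · convert (hH _ x hx rfl).2.2.1 x (hself x hx) using 1
    rw [Finset.filter_filter]
    refine Finset.filter_congr fun y hy => ?_
    change H (ρ y) y = H (ρ x) x ↔ ρ y = ρ x ∧ H (ρ x) y = H (ρ x) x
    refine ⟨fun h => ?_, fun h => ?_⟩
    · have hyx : ρ y = ρ x := by rw [← (hmem y hy).2, ← (hmem x hx).2, h]
      exact ⟨hyx, by rw [← h, hyx]⟩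
    · rw [h.1]
      exact h.2
  · convert (hH _ x hx rfl).2.2.2 using 2
    refine Finset.image_congr fun y hy => ?_
    simp only [(Finset.mem_filter.1 (Finset.mem_coe.1 hy)).2]

/-- A leaf of level `j` is the last point of `U`, so there is at most one, and it becomes a piece of
its own after the others. -/
theorem Pieces.add_leaf {𝒜 : SeqClass} {d : ℕ+ → ℕ} {j r : ℕ} {U : Finset ℕ+}
    (hd : ∀ x ∈ U, d x = j → ∀ y ∈ U, y ≤ x)
    (hU : Pieces (Tree 𝒜 d j) r (U.filter (d · ≠ j))) : Pieces (Tree 𝒜 d j) (r + 1) U := by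
  obtain ⟨h, hh, hm, hT, hr⟩ := hU
  have hmem : ∀ x ∈ U, d x ≠ j → h x ∈ U ∧ d (h x) ≠ j := fun x hx hdx =>
    Finset.mem_filter.1 (hh.mem x (Finset.mem_filter.2 ⟨hx, hdx⟩))
  let g : ℕ+ → ℕ+ := fun x => if d x = j then x else h x
  have g₁ : ∀ x, d x = j → g x = x := fun x hx => if_pos hx
  have g₂ : ∀ x, d x ≠ j → g x = h x := fun x hx => if_neg hx
  have hle : ∀ x ∈ U, g x ≤ x := by
    intro x hx
    by_cases hdx : d x = j
    · rw [g₁ x hdx]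
    · rw [g₂ x hdx]; exact hh.le x (Finset.mem_filter.2 ⟨hx, hdx⟩)
  refine ⟨g, ⟨?_, hle, ?_⟩, ?_, ?_, ?_⟩
  · intro x hx
    by_cases hdx : d x = j
    · rwa [g₁ x hdx]
    · rw [g₂ x hdx]; exact (hmem x hx hdx).1
  · intro x hx
    by_cases hdx : d x = j
    · rw [g₁ x hdx, g₁ x hdx]
    · rw [g₂ x hdx, g₂ _ (hmem x hx hdx).2]
      exact hh.idem x (Finset.mem_filter.2 ⟨hx, hdx⟩)
  · intro x hx y hy hxy
    by_cases hdy : d y = j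
    · rw [g₁ y hdy]
      exact (hle x hx).trans hxy
    · by_cases hdx : d x = j
      · obtain rfl := le_antisymm hxy (hd x hx hdx y hy)
        exact le_rfl
      · rw [g₂ x hdx, g₂ y hdy]
        exact hm (Finset.mem_coe.2 (Finset.mem_filter.2 ⟨hx, hdx⟩))
          (Finset.mem_coe.2 (Finset.mem_filter.2 ⟨hy, hdy⟩)) hxy
  · intro x hx
    by_cases hdx : d x = j
    · have : U.filter (g · = g x) = {x} := by
        ext y
        rw [Finset.mem_filter, Finset.mem_singleton, g₁ x hdx]
        constructor
        · rintro ⟨hy, hyx⟩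
          by_cases hdy : d y = j
          · rwa [g₁ y hdy] at hyx
          · rw [g₂ y hdy] at hyx
            exact absurd hdx (hyx ▸ (hmem y hy hdy).2)
        · rintro rfl
          exact ⟨hx, g₁ _ hdx⟩
      rw [this]
      exact .leaf hdx
    · convert hT x (Finset.mem_filter.2 ⟨hx, hdx⟩) using 1
      rw [Finset.filter_filter]
      refine Finset.filter_congr fun y hy => ?_
      rw [g₂ x hdx]
      constructor
      · intro hyx
        by_cases hdy : d y = j
        · rw [g₁ y hdy] at hyx
          exact absurd (hyx ▸ hdy) (hmem x hx hdx).2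
        · rw [g₂ y hdy] at hyx
          exact ⟨hdy, hyx⟩
      · rintro ⟨hdy, hyx⟩
        rwa [g₂ y hdy]
  · have hsub : U.image g ⊆ (U.filter (d · ≠ j)).image h ∪ U.filter (d · = j) := by
      intro p hp
      obtain ⟨x, hx, rfl⟩ := Finset.mem_image.1 hp
      rw [Finset.mem_union]
      by_cases hdx : d x = j
      · rw [g₁ x hdx]
        exact Or.inr (Finset.mem_filter.2 ⟨hx, hdx⟩)
      · rw [g₂ x hdx]
        exact Or.inl (Finset.mem_image_of_mem _ (Finset.mem_filter.2 ⟨hx, hdx⟩))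
    have h1 : (U.filter (d · = j)).card ≤ 1 := by
      refine Finset.card_le_one.2 fun x hx y hy => ?_
      rw [Finset.mem_filter] at hx hy
      exact le_antisymm (hd y hy.1 hy.2 x hx.1) (hd x hx.1 hx.2 y hy.1)
    have h2 := (Finset.card_le_card hsub).trans (Finset.card_union_le _ _)
    omega

/-! ### From paired trees to admissible trees -/

theorem exists_glued {𝒜 : SeqClass} {d : ℕ+ → ℕ} {j r : ℕ}
    {A : Finset ℕ+} {ρ : ℕ+ → ℕ+} (hm : MonotoneOn ρ A)
    (hleaf : ∀ x ∈ A, d x = j + 1 → ∀ y ∈ A, ρ y = ρ x → y ≤ x)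
    (hA : ∀ x ∈ A, Pieces (Tree 𝒜 d (j + 1)) r
      ((A.filter (ρ · = ρ x)).filter (d · ≠ j + 1))) :
    ∃ h : ℕ+ → ℕ+, IsHead h A ∧ MonotoneOn h A ∧
      (∀ x ∈ A, Tree 𝒜 d (j + 1) (A.filter (h · = h x))) ∧
      (∀ x ∈ A, ρ (h x) = ρ x) ∧ ∀ x ∈ A, ((A.filter (ρ · = ρ x)).image h).card ≤ r + 1 := by
  refine Pieces.glue hm fun x hx => (hA x hx).add_leaf fun y hy hdy z hz => ?_
  rw [Finset.mem_filter] at hy hz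
  exact hleaf y hy.1 hdy z hz.1 (hz.2.trans hy.2.symm)

/-- Grouped by `ρ`, the heads form consecutive sets of at most `n` points, whose minima dominate
distinct elements of `M` through `ρ`. -/
theorem IsRegular.image_mem_bracket {ℱ : Set (Finset ℕ+)} (hℱ : IsRegular ℱ) {A M : Finset ℕ+}
    {ρ h : ℕ+ → ℕ+} {n : ℕ} (hm : MonotoneOn ρ A) (hle : ∀ x ∈ A, ρ x ≤ x) (hM : M ∈ ℱ)
    (hρM : ∀ x ∈ A, ρ x ∈ M) (hh : IsHead h A) (hρh : ∀ x ∈ A, ρ (h x) = ρ x)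
    (hc : ∀ x ∈ A, ((A.filter (ρ · = ρ x)).image h).card ≤ n) :
    A.image h ∈ bracket ℱ (cardLE n) := by
  let e := (A.image ρ).orderEmbOfFin rfl
  have he : ∀ i, ∃ x ∈ A, ρ x = e i := fun i =>
    Finset.mem_image.1 (Finset.orderEmbOfFin_mem (A.image ρ) rfl i)
  have hF : ∀ i, ∀ q ∈ (A.filter (ρ · = e i)).image h, q ∈ A ∧ ρ q = e i := by
    intro i q hq
    obtain ⟨x, hx, rfl⟩ := Finset.mem_image.1 hq
    rw [Finset.mem_filter] at hx
    exact ⟨hh.mem x hx.1, (hρh x hx.1).trans hx.2⟩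
  have hne : ∀ i, ((A.filter (ρ · = e i)).image h).Nonempty := by
    intro i
    obtain ⟨x, hx, hxe⟩ := he i
    exact ⟨h x, Finset.mem_image_of_mem _ (Finset.mem_filter.2 ⟨hx, hxe⟩)⟩
  refine ⟨(A.image ρ).card, fun i => (A.filter (ρ · = e i)).image h, ?_, ⟨?_, hne, ?_⟩, ?_⟩
  · intro i
    obtain ⟨x, hx, hxe⟩ := he i
    change ((A.filter (ρ · = e i)).image h).card ≤ n
    rw [← hxe]
    exact hc x hx
  · intro i i' hi a ha b hb
    exact before_fiber hm (e.lt_iff_lt.2 hi) a (Finset.mem_filter.2 (hF i a ha)) b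
      (Finset.mem_filter.2 (hF i' b hb))
  · have hmin : ∀ q ∈ Finset.univ.image
        (fun i => ((A.filter (ρ · = e i)).image h).min' (hne i)), ∃ i, q ∈ A ∧ ρ q = e i ∧
          q = ((A.filter (ρ · = e i)).image h).min' (hne i) := by
      intro q hq
      obtain ⟨i, -, rfl⟩ := Finset.mem_image.1 hq
      exact ⟨i, (hF i _ (Finset.min'_mem _ _)).1, (hF i _ (Finset.min'_mem _ _)).2, rfl⟩
    refine hℱ.mem_of_injOn (ψ := ρ) ?_ ?_ ?_ hM
    · intro q hq r hr hqr
      obtain ⟨i, -, hi, hqi⟩ := hmin q hq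
      obtain ⟨i', -, hi', hri⟩ := hmin r hr
      obtain rfl : i = i' := e.injective (by rw [← hi, ← hi', hqr])
      rw [hqi, hri]
    · intro q hq
      obtain ⟨i, hi, -⟩ := hmin q hq
      exact hle q hi
    · intro q hq
      obtain ⟨i, hi, -⟩ := hmin q hq
      exact hρM q hi
  · ext q
    simp only [Finset.mem_biUnion, Finset.mem_univ, true_and, Finset.mem_image,
      Finset.mem_filter]
    constructor
    · rintro ⟨x, hx, rfl⟩
      have h : ρ x ∈ Set.range e := by
        rw [Finset.range_orderEmbOfFin]
        exact Finset.mem_coe.2 (Finset.mem_image_of_mem _ hx)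
      obtain ⟨i, hi⟩ := h
      exact ⟨i, x, ⟨hx, hi.symm⟩, rfl⟩
    · rintro ⟨_, x, ⟨hx, _⟩, rfl⟩
      exact ⟨x, hx, rfl⟩

/-- One piece for the inner node and one for the leaf make at most two heads per pair, which is what
`𝒜_2` allows. -/
theorem PairNode.pieces_bracket {ℱ : Set (Finset ℕ+)} (hℱ : IsRegular ℱ) {d : ℕ+ → ℕ} {j : ℕ}
    {A : Finset ℕ+} (hA : PairNode ℱ d j A) :
    Pieces (Tree (admissible (bracket ℱ (cardLE 2))) d j) 1 A := by
  induction hA with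
  | mk ρ hm hle hM hρ hleaf _ ih =>
    obtain ⟨h, hh, hhm, hT, hρh, hc⟩ := exists_glued hm hleaf ih
    exact .of_nonempty fun _ => .of_isHead_admissible hh hhm
      (hℱ.image_mem_bracket hm hle hM hρ hh hρh hc) hT

/-- Two pieces for the inner node and one for the leaf make at most three heads per pair; the heads
then split into two consecutive members of `𝒮_ξ`, which leaves two pieces at every level. -/
theorem PairNode.pieces_schreier {α : Ordinal.{0} → ℕ+ → Ordinal.{0}} (hα : IsApproximating α)
    {ξ : Ordinal.{0}} (h1 : ξ < ω₁) (h0 : ξ ≠ 0) {d : ℕ+ → ℕ} {j : ℕ} {A : Finset ℕ+}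
    (hA : PairNode (schreier α ξ) d j A) :
    Pieces (Tree (admissible (schreier α ξ)) d j) 2 A := by
  classical
  induction hA with
  | @mk j A M ρ hm hle hM hρ hleaf _ ih =>
    obtain ⟨h, hh, hhm, hT, hρh, hc⟩ := exists_glued hm hleaf ih
    have hmem : ∀ q ∈ A.image h, q ∈ A := by
      intro q hq
      obtain ⟨x, hx, rfl⟩ := Finset.mem_image.1 hq
      exact hh.mem x hx
    have hhh : ∀ q ∈ A.image h, h q = q := by
      intro q hq
      obtain ⟨x, hx, rfl⟩ := Finset.mem_image.1 hq
      exact hh.idem x hx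
    obtain ⟨C, hCs, hC, hC', hb⟩ := exists_two_schreier hα h1 h0 (C := A.image h) (π := ρ)
      (hm.mono fun q hq => hmem q hq) (fun q hq => hle q (hmem q hq)) (by
        intro q hq
        refine (Finset.card_le_card fun p hp => ?_).trans (hc q (hmem q hq))
        rw [Finset.mem_filter] at hp
        exact Finset.mem_image.2 ⟨p, Finset.mem_filter.2 ⟨hmem p hp.1, hp.2⟩, hhh p hp.1⟩) (by
        refine mem_schreier_of_subset hα h1 hM fun p hp => ?_
        obtain ⟨q, hq, rfl⟩ := Finset.mem_image.1 hp
        exact hρ q (hmem q hq))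
    have h12 : (1 : ℕ+) < 2 := by decide
    have hpart : ∀ (D : Finset ℕ+), D ∈ schreier α ξ →
        ∀ B, (∀ x, x ∈ B ↔ x ∈ A ∧ h x ∈ D) → Tree (admissible (schreier α ξ)) d j B := by
      intro D hD B hB
      have hBA : B ⊆ A := fun x hx => ((hB x).1 hx).1
      refine .of_isHead_admissible (h := h) ⟨fun x hx => ?_, fun x hx => hh.le x (hBA hx),
        fun x hx => hh.idem x (hBA hx)⟩ (hhm.mono (Finset.coe_subset.2 hBA)) ?_ fun x hx => ?_
      · rw [hB, hh.idem x (hBA hx)]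
        exact ⟨hh.mem x (hBA hx), ((hB x).1 hx).2⟩
      · refine mem_schreier_of_subset hα h1 hD fun p hp => ?_
        obtain ⟨x, hx, rfl⟩ := Finset.mem_image.1 hp
        exact ((hB x).1 hx).2
      · convert hT x (hBA hx) using 1
        ext y
        rw [Finset.mem_filter, Finset.mem_filter]
        refine ⟨fun hy => ⟨hBA hy.1, hy.2⟩, fun hy => ⟨(hB y).2 ⟨hy.1, ?_⟩, hy.2⟩⟩
        rw [hy.2]
        exact ((hB x).1 hx).2
    -- The labels 1 and 2 cut `A` at the point where the heads pass from `C` to the remaining ones.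
    let g : ℕ+ → ℕ+ := fun x => if h x ∈ C then 1 else 2
    have hg1 : ∀ x, g x = 1 ↔ h x ∈ C := by
      intro x
      by_cases hx : h x ∈ C
      · simp [g, hx]
      · simp only [g, if_neg hx, hx, iff_false]
        exact h12.ne'
    have hg2 : ∀ x, g x = 2 ↔ h x ∉ C := by
      intro x
      by_cases hx : h x ∈ C
      · simp only [g, if_pos hx, hx, not_true, iff_false]
        exact h12.ne
      · simp [g, hx]
    have hg : ∀ x, g x = 1 ∨ g x = 2 := fun x => by rw [hg1, hg2]; exact em _
    have hgm : MonotoneOn g A := by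
      intro x hx y hy hxy
      rcases hg x with hx1 | hx2
      · rw [hx1]; exact one_le
      · rcases hg y with hy1 | hy2
        · have h2 := hhm hx hy hxy
          exact absurd (hb _ ((hg1 y).1 hy1) _ (Finset.mem_sdiff.2
            ⟨Finset.mem_image_of_mem _ hx, (hg2 x).1 hx2⟩)) (not_lt.2 h2)
        · rw [hx2, hy2]
    obtain ⟨f, hf, hfm, hfT, -, hfc⟩ := Pieces.glue (T := Tree (admissible (schreier α ξ)) d j)
      (r := 1) hgm fun x hx => .of_nonempty fun _ => by
        rcases hg x with hx1 | hx2
        · refine hpart C hC _ fun y => ?_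
          rw [Finset.mem_filter, hx1, hg1]
        · refine hpart _ hC' _ fun y => ?_
          rw [Finset.mem_filter, hx2, hg2, Finset.mem_sdiff]
          exact ⟨fun hy => ⟨hy.1, Finset.mem_image_of_mem _ hy.1, hy.2⟩,
            fun hy => ⟨hy.1, hy.2.2⟩⟩
    refine ⟨f, hf, hfm, hfT, ?_⟩
    have hle1 : ∀ p, ((A.filter (g · = p)).image f).card ≤ 1 := by
      intro p
      rcases (A.filter (g · = p)).eq_empty_or_nonempty with he | ⟨x, hx⟩
      · rw [he]; simp
      · rw [Finset.mem_filter] at hx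
        rw [← hx.2]
        exact hfc x hx.1
    have hU : A.image f = (A.filter (g · = 1)).image f ∪ (A.filter (g · = 2)).image f := by
      rw [← Finset.image_union, ← Finset.filter_or, Finset.filter_true_of_mem fun x _ => hg x]
    rw [hU]
    exact (Finset.card_union_le _ _).trans (add_le_add (hle1 1) (hle1 2))

/-! ### Comparison of the norms -/

theorem Pieces.sum_le {𝒜 : SeqClass} {θ : ℝ} (hθ0 : 0 ≤ θ) (hθ1 : θ ≤ 1) {d : ℕ+ → ℕ} {j r : ℕ}
    {A : Finset ℕ+} (hA : Pieces (Tree 𝒜 d j) r A) (x : ℕ+ →₀ ℝ) :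
    ∑ a ∈ A, θ ^ d a * |x a| ≤ r * (θ ^ j * implicitNorm 𝒜 θ x) := by
  obtain ⟨h, -, -, hT, hc⟩ := hA
  rw [← Finset.sum_fiberwise_of_maps_to (t := A.image h) (g := h)
    fun a ha => Finset.mem_image_of_mem _ ha]
  refine (Finset.sum_le_card_nsmul _ _ (θ ^ j * implicitNorm 𝒜 θ x) fun p hp => ?_).trans ?_
  · obtain ⟨a, ha, rfl⟩ := Finset.mem_image.1 hp
    exact (hT a ha).sum_le hθ0 hθ1 x
  · rw [nsmul_eq_mul]
    exact mul_le_mul_of_nonneg_right (by exact_mod_cast hc)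
      (mul_nonneg (pow_nonneg hθ0 _) (implicitNorm_nonneg hθ0 hθ1 x))

/-- Since the rearrangement keeps the leaves and their levels, the sum attached to an allowable tree
is a sum over at most `r` trees of the class `𝒜`. -/
theorem IsRegular.modifiedNorm_le {ℱ : Set (Finset ℕ+)} (hℱ : IsRegular ℱ) {𝒜 : SeqClass}
    {r : ℕ} (hr : 1 ≤ r)
    (h : ∀ (d : ℕ+ → ℕ) (A : Finset ℕ+), PairNode ℱ d 0 A → Pieces (Tree 𝒜 d 0) r A)
    {θ : ℝ} (hθ0 : 0 < θ) (hθ1 : θ ≤ 1) (x : ℕ+ →₀ ℝ) :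
    modifiedNorm ℱ θ x ≤ r * implicitNorm 𝒜 θ x := by
  have hN := implicitNorm_nonneg (𝒜 := 𝒜) hθ0.le hθ1 x
  refine ciSup_le fun n => le_of_forall_lt fun c hc => ?_
  rcases lt_or_ge c 0 with hc0 | hc0
  · exact hc0.trans_le (mul_nonneg (Nat.cast_nonneg r) hN)
  obtain ⟨A, d, hA, -, hsum⟩ := hℱ.exists_tree hθ0 n x c 0 hc0 hc
  rw [pow_zero, one_mul] at hsum
  refine hsum.trans_le ?_
  have hP : Pieces (Tree 𝒜 d 0) r A := by
    rcases hA.leaf_or_node with ⟨a, hda, rfl⟩ | ⟨hd, -⟩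
    · obtain ⟨g, h1, h2, h3, h4⟩ := Pieces.of_nonempty (T := Tree 𝒜 d 0) (U := {a})
        fun _ => .leaf hda
      exact ⟨g, h1, h2, h3, h4.trans hr⟩
    -- The tree is a single fiber of the constant label 1. No new labels arise, so it stays a single
    -- pair, and without leaves of level 0 that pair is an inner node.
    · obtain ⟨ρ, -, -, hQ, hf⟩ := hℱ.exists_pairSet (A.sup d + 1) 0 (A := A) (d := d)
        (π := fun _ => 1) (fun a ha => by have := Finset.le_sup (f := d) ha; omega)
        (fun _ _ => one_le) (fun a _ => by simpa using hA)
      have hρ : ∀ a ∈ A, ρ a = 1 := fun a ha => by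
        obtain ⟨_, _, h⟩ := Finset.mem_image.1 (hQ a ha)
        exact h.symm
      refine h d A ?_
      rcases A.eq_empty_or_nonempty with rfl | ⟨a, ha⟩
      · exact .mk id monotoneOn_id (by simp) hℱ.empty_mem (by simp) (by simp) (by simp)
      · convert (hf a ha).2 using 1
        rw [Finset.filter_filter]
        refine (Finset.filter_true_of_mem fun b hb => ⟨?_, ?_⟩).symm
        · rw [hρ a ha, hρ b hb]
        · have := hd b hb
          omega
  simpa using hP.sum_le hθ0.le hθ1 x

theorem implicitNorm_mono {𝒜 ℬ : SeqClass} {θ : ℝ} (hθ0 : 0 ≤ θ) (hθ1 : θ ≤ 1)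
    (h : ∀ {k : ℕ} {E : Fin k → Finset ℕ+}, 𝒜.Mem E → ℬ.Mem E) (x : ℕ+ →₀ ℝ) :
    implicitNorm 𝒜 θ x ≤ implicitNorm ℬ θ x := by
  refine ciSup_le fun n => ?_
  refine le_trans ?_ (iter_le_implicitNorm hθ0 hθ1 n x)
  induction n generalizing x with
  | zero => exact le_rfl
  | succ n ih =>
    refine max_le_max le_rfl (mul_le_mul_of_nonneg_left (Real.sSup_le ?_ ?_) hθ0)
    · rintro _ ⟨k, E, hE, rfl⟩
      exact (Finset.sum_le_sum fun i _ => ih _).trans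
        (le_csSup (bddAbove_sums (iter_le_l1 hθ0 hθ1 n) x) ⟨k, E, h hE, rfl⟩)
    · exact sSup_sums_nonneg (iter_nonneg n) x

theorem tsirelsonNorm_le_modifiedNorm (ℱ : Set (Finset ℕ+)) {θ : ℝ} (hθ0 : 0 ≤ θ) (hθ1 : θ ≤ 1)
    (x : ℕ+ →₀ ℝ) : tsirelsonNorm ℱ θ x ≤ modifiedNorm ℱ θ x :=
  implicitNorm_mono hθ0 hθ1 (𝒜 := admissible ℱ) (ℬ := allowable ℱ)
    (fun {_ _} hE => And.intro ((admissible ℱ).disjoint hE) hE.2) x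

/-- Disjoint nonempty sets have distinct minima, so the sequence has at most one term. -/
theorem isAdmissible_of_isAllowable_cardLE_one {k : ℕ} {E : Fin k → Finset ℕ+}
    (hE : IsAllowable {A | A.card ≤ 1} E) : IsAdmissible {A | A.card ≤ 1} E := by
  refine ⟨fun i j hij => ?_, hE.2⟩
  obtain ⟨hd, hne, hc⟩ := hE
  have := Finset.card_le_one.1 hc _ (Finset.mem_image_of_mem _ (Finset.mem_univ i)) _
    (Finset.mem_image_of_mem _ (Finset.mem_univ j))
  exact absurd (this ▸ Finset.min'_mem _ (hne j))
    (Finset.disjoint_left.1 (hd i j hij.ne) (Finset.min'_mem _ (hne i)))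

section

variable {α : Ordinal.{0} → ℕ+ → Ordinal.{0}}

theorem modifiedNorm_le_bracket (hα : IsApproximating α) {ξ : Ordinal.{0}} (h1 : ξ < ω₁) {θ : ℝ}
    (hθ0 : 0 < θ) (hθ1 : θ ≤ 1) (x : ℕ+ →₀ ℝ) :
    modifiedNorm (schreier α ξ) θ x ≤ tsirelsonNorm (bracket (schreier α ξ) (cardLE 2)) θ x := by
  have h := isRegular_schreier hα h1
  simpa [tsirelsonNorm] using
    h.modifiedNorm_le le_rfl (fun d A hA => hA.pieces_bracket h) hθ0 hθ1 x

theorem modifiedNorm_le_two_mul (hα : IsApproximating α) {ξ : Ordinal.{0}} (h1 : ξ < ω₁) {θ : ℝ}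
    (hθ0 : 0 < θ) (hθ1 : θ ≤ 1) (x : ℕ+ →₀ ℝ) :
    modifiedNorm (schreier α ξ) θ x ≤ 2 * tsirelsonNorm (schreier α ξ) θ x := by
  by_cases h0 : ξ = 0
  · subst h0
    have hN : 0 ≤ tsirelsonNorm (schreier α 0) θ x := implicitNorm_nonneg hθ0.le hθ1 x
    refine le_trans (implicitNorm_mono hθ0.le hθ1 (fun {k E} hE => ?_) x)
      (by linarith : tsirelsonNorm (schreier α 0) θ x ≤ _)
    change IsAllowable _ E at hE
    change IsAdmissible _ E
    rw [schreier_zero] at hE ⊢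
    exact isAdmissible_of_isAllowable_cardLE_one hE
  · simpa [tsirelsonNorm] using (isRegular_schreier hα h1).modifiedNorm_le one_le_two
      (fun d A hA => hA.pieces_schreier hα h1 h0) hθ0 hθ1 x

end

/-! ### The isomorphism of the completions -/

/-- If the norms of two classes of sequences are equivalent on `c₀₀`, then the identity of `c₀₀`
extends to an isomorphism of the completions. -/
theorem exists_equiv_of_implicitNorm_le {𝒜 ℬ : SeqClass} {θ : Set.Ioo (0 : ℝ) 1} {C : ℝ}
    (h1 : ∀ x, implicitNorm ℬ θ x ≤ implicitNorm 𝒜 θ x)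
    (h2 : ∀ x, implicitNorm 𝒜 θ x ≤ C * implicitNorm ℬ θ x) :
    ∃ Φ : ImplicitSpace 𝒜 θ ≃L[ℝ] ImplicitSpace ℬ θ, (∀ x, Φ (incl 𝒜 θ x) = incl ℬ θ x) ∧
      ∀ y, ‖Φ y‖ ≤ ‖y‖ ∧ ‖y‖ ≤ C * ‖Φ y‖ := by
  let f : C00 𝒜 θ →L[ℝ] C00 ℬ θ := LinearMap.mkContinuous
    { toFun := fun x => x, map_add' := fun _ _ => rfl, map_smul' := fun _ _ => rfl } 1
    fun x => by rw [one_mul]; exact h1 x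
  let g : C00 ℬ θ →L[ℝ] C00 𝒜 θ := LinearMap.mkContinuous
    { toFun := fun x => x, map_add' := fun _ _ => rfl, map_smul' := fun _ _ => rfl } C
    fun x => h2 x
  have hgf : ∀ y, g.completion (f.completion y) = y := fun y => by
    induction y using UniformSpace.Completion.induction_on with
    | hp => exact isClosed_eq (g.completion.continuous.comp f.completion.continuous) continuous_id
    | ih x =>
      rw [ContinuousLinearMap.completion_apply_coe, ContinuousLinearMap.completion_apply_coe]
      rfl
  have hfg : ∀ y, f.completion (g.completion y) = y := fun y => by
    induction y using UniformSpace.Completion.induction_on with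
    | hp => exact isClosed_eq (f.completion.continuous.comp g.completion.continuous) continuous_id
    | ih x =>
      rw [ContinuousLinearMap.completion_apply_coe, ContinuousLinearMap.completion_apply_coe]
      rfl
  have hΦ : ∀ x, f.completion (incl 𝒜 θ x) = incl ℬ θ x := fun x =>
    f.completion_apply_coe x
  refine ⟨ContinuousLinearEquiv.equivOfInverse f.completion g.completion hgf hfg, hΦ, fun y => ?_⟩
  change ‖f.completion y‖ ≤ ‖y‖ ∧ ‖y‖ ≤ C * ‖f.completion y‖
  induction y using UniformSpace.Completion.induction_on with
  | hp =>
    have hc := f.completion.continuous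
    exact (isClosed_le hc.norm continuous_norm).inter
      (isClosed_le continuous_norm (continuous_const.mul hc.norm))
  | ih x =>
    have hfx : ‖f.completion (x : UniformSpace.Completion (C00 𝒜 θ))‖ = implicitNorm ℬ θ x := by
      rw [ContinuousLinearMap.completion_apply_coe]
      exact norm_incl ℬ θ x
    have hx : ‖(x : UniformSpace.Completion (C00 𝒜 θ))‖ = implicitNorm 𝒜 θ x := norm_incl 𝒜 θ x
    rw [hx, hfx]
    exact ⟨h1 x, h2 x⟩

end Tsirelson

open Tsirelson in
theorem theorem4p2 (α : Ordinal.{0} → ℕ+ → Ordinal.{0}) (hα : IsApproximating α)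
    (ξ : Ordinal.{0}) (hξ : ξ < Ordinal.omega 1) (θ : Set.Ioo (0 : ℝ) 1) :
    (∀ x : ℕ+ →₀ ℝ,
      modifiedNorm (schreier α ξ) θ x ≤ tsirelsonNorm (bracket (schreier α ξ) (cardLE 2)) θ x ∧
      tsirelsonNorm (schreier α ξ) θ x ≤ modifiedNorm (schreier α ξ) θ x ∧
      modifiedNorm (schreier α ξ) θ x ≤ 3 * tsirelsonNorm (schreier α ξ) θ x) ∧
    ∃ Φ : ModifiedSpace (schreier α ξ) θ ≃L[ℝ] TsirelsonSpace (schreier α ξ) θ,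
      (∀ x : ℕ+ →₀ ℝ, Φ (incl (allowable (schreier α ξ)) θ x)
        = incl (admissible (schreier α ξ)) θ x) ∧
      ∀ y, ‖Φ y‖ ≤ ‖y‖ ∧ ‖y‖ ≤ 3 * ‖Φ y‖ := by
  -- The constant 2 is relaxed to 3 by nonnegativity of the norm.
  have h3 : ∀ x, modifiedNorm (schreier α ξ) θ x ≤ 3 * tsirelsonNorm (schreier α ξ) θ x := by
    intro x
    have hN : 0 ≤ tsirelsonNorm (schreier α ξ) θ x := implicitNorm_nonneg θ.2.1.le θ.2.2.le x
    linarith [modifiedNorm_le_two_mul hα hξ θ.2.1 θ.2.2.le x]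
  have h2 := tsirelsonNorm_le_modifiedNorm (schreier α ξ) θ.2.1.le θ.2.2.le
  exact ⟨fun x => ⟨modifiedNorm_le_bracket hα hξ θ.2.1 θ.2.2.le x, h2 x, h3 x⟩,
    exists_equiv_of_implicitNorm_le h2 h3⟩
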